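/- Let $\kappa=1$ (bosonic case) or $\kappa=-1$ (fermionic case). A *Krein space* is a complex space $V=V^+\oplus V^-$ with a fixed decomposition and a Hermitian inner product $\{\cdot,\cdot\}$ (conjugate linear in the first argument) for which the sum is orthogonal, $\{\cdot,\cdot\}$ is positive definite on $V^+$ and negative definite on $V^-$, and $V^+\oplus\overline{V^-}$ (sign reversed on $V^-$) is a Hilbert space; write $[v]=0$ for $v\in V^+$ and $[v]=1$ for $0\ne v\in V^-$. A subspace $W$ is *adapted* if $W=(W\cap V^+)\oplus(W\cap V^-)$; a Krein subspace is an adapted complex subspace, and an orthonormal basis of it consists of vectors of $V^\pm$ that are orthonormal for the Hilbert inner product. Call a real subspace $W\subseteq V$ *admissible* if * ($\kappa=1$) $W$ is closed, adapted, and Lagrangian for $\operatorname{Im}\{\cdot,\cdot\}$; * ($\kappa=-1$) $W$ equals its orthogonal companion for $\operatorname{Re}\{\cdot,\cdot\}$ and is the fixed point set of a conjugate linear involution $u$ of $V$ with $u(V^\pm)\subseteq V^\mp$ and $\operatorname{Re}\{u v,u w\}=-\operatorname{Re}\{v,w\}$. Then $V=W\oplus \mathrm{i}W$. For $\xi=\xi^R+\mathrm{i}\xi^I$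 with $\xi^R,\xi^I\in W$ put $$B_W(\xi,\eta)=\{\xi^R,\eta^R\}-\mathrm{i}\{\xi^R,\eta^I\}-\mathrm{i}\{\xi^I,\eta^R\}-\{\xi^I,\eta^I\}.$$ *States.* For $\xi_1,\dots,\xi_n\in V$ let $\psi[\xi_1,\dots,\xi_n]$ be the $n$-linear map $$\psi[\xi_1,\dots,\xi_n](\eta_1,\dots,\eta_n)=\frac1{n!}\sum_{\sigma\in S^n}\kappa^{|\sigma|}\prod_{i=1}^n\{\xi_i,\eta_{\sigma(i)}\},$$ an element of the space $\mathcal F_n(V)$ of continuous $n$-linear maps $V^n\to\mathbb C$ that are symmetric ($\kappa=1$) or antisymmetric ($\kappa=-1$); $\psi[\,]=\mathbf 1\in\mathcal F_0(V)=\mathbb C$. Let $\mathcal H^\circ_V$ be the span of all these states in $\bigoplus_n\mathcal F_n(V)$. For an admissible $W$ let $\rho_W:\mathcal H_V^\circ\to\mathbb C$ be the (well-defined) linear map with $\rho_W(\psi[\xi_1,\dots,\xi_n])=0$ for odd $n$ and $$\rho_W(\psi[\xi_1,\dots,\xi_{2n}])=\frac1{n!}\sum_{\sigma\in S^{2n}}\kappa^{|\sigma|}\prod_{j=1}^nB_W(\xi_{\sigma(j)},\xi_{\sigma(2n+1-j)}),\qquad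 \rho_W(\mathbf 1)=1.$$ *Gluing data.* Let $L_{\Sigma_1},L_\Sigma,L_{\overline{\Sigma'}}$ be Krein spaces and $L_\Sigma\to L_{\overline{\Sigma'}}$, $\phi\mapsto\bar\phi$, a conjugate linear homeomorphic bijection with $\{\bar\phi',\bar\phi\}=\kappa\,\overline{\{\phi',\phi\}}$. Put $L_{\partial M}=L_{\Sigma_1}\oplus L_\Sigma\oplus L_{\overline{\Sigma'}}$ (orthogonal direct sum). Let $L_M,L_{M_1}$ be real vector spaces, $r_M:L_M\to L_{\partial M}$ and $r_{M_1}:L_{M_1}\to L_{\Sigma_1}$ real linear maps with admissible images $L_{\tilde M}$ and $L_{\tilde M_1}$, and $L_{M_1}\hookrightarrow L_M$ an injective linear map whose image consists exactly of the $x$ for which $r_M(x)$ has the form $(\phi,\tilde\phi,\bar{\tilde\phi})$, and which composed with $r_M$ and the projection to $L_{\Sigma_1}$ gives $r_{M_1}$. Write $\rho_M=\rho_{L_{\tilde M}}$ and $\rho_{M_1}=\rho_{L_{\tilde M_1}}$. Let $\tau$ be the product given on $\psi_1\in\mathcal F_m(V_1)$, $\psi_2\in\mathcal F_n(V_2)$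 by $$\tau(\psi_1\otimes\psi_2)((\eta_1,\xi_1),\dots,(\eta_{m+n},\xi_{m+n}))=\frac1{(m+n)!}\sum_{\sigma\in S^{m+n}}\kappa^{|\sigma|}\psi_1(\eta_{\sigma(1)},\dots,\eta_{\sigma(m)})\,\psi_2(\xi_{\sigma(m+1)},\dots,\xi_{\sigma(m+n)}),$$ extended (associatively) to three factors, and let $\iota:\bigoplus_n\mathcal F_n(L_\Sigma)\to\bigoplus_n\mathcal F_n(L_{\overline{\Sigma'}})$ be given by $(\iota\psi)(\bar\xi_1,\dots,\bar\xi_n)=\overline{\psi(\xi_n,\dots,\xi_1)}$. For $\psi\in\mathcal H^\circ_{L_{\Sigma_1}}$ and vectors $\xi=(\xi_1,\dots,\xi_d)$ of $L_\Sigma$ put $$T_m(\psi,\xi)=\frac1{2^m\,m!}\sum_{a_1,\dots,a_m=1}^{d}(-1)^{\sum_{i}[\xi_{a_i}]}\,\rho_M\big(\tau(\psi\otimes\psi[\xi_{a_1},\dots,\xi_{a_m}]\otimes\iota(\psi[\xi_{a_1},\dots,\xi_{a_m}]))\big).$$ For a finite-dimensional Krein subspace $L_{\Sigma,\alpha}\subseteq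 L_\Sigma$ say that $c_\alpha$ is *well defined* if $c_\alpha=\sum_{m\ge0}T_m(\mathbf 1,\eta)$ converges absolutely, where $\eta$ is an orthonormal basis of $L_{\Sigma,\alpha}$. **Statement.** Let $\phi_1,\dots,\phi_n\in L_{\tilde M_1}$ and let $\tilde\phi_1,\dots,\tilde\phi_n\in L_\Sigma$ satisfy $(\phi_i,\tilde\phi_i,\bar{\tilde\phi}_i)\in L_{\tilde M}$. Let $L_{\Sigma,\alpha}$ be a finite-dimensional Krein subspace of $L_\Sigma$ that contains $\tilde\phi_1,\dots,\tilde\phi_n$, and suppose that $c_\alpha$ is well defined. Then for every orthonormal basis $\xi=(\xi_1,\dots,\xi_d)$ of $L_{\Sigma,\alpha}$ the following series converges absolutely and $$\rho_{M_1}(\psi[\phi_1,\dots,\phi_n])\cdot c_\alpha=\sum_{m=0}^\infty T_m(\psi[\phi_1,\dots,\phi_n],\xi).$$ -/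

import Mathlib

open scoped ComplexConjugate

noncomputable section

namespace GBF

/-! ### Krein spaces (with a fixed decomposition) -/

/-- A (strict) complex Krein space: a complex Hilbert space `V` with a distinguished closed
subspace `V⁺ = pos`; then `V⁻ = (V⁺)ᗮ`, and the indefinite inner product agrees with the Hilbert
inner product on `V⁺` and with its negative on `V⁻`. -/
class KreinSpace (V : Type*) [NormedAddCommGroup V] [InnerProductSpace ℂ V]
    [CompleteSpace V] where
  /-- The positive part `V⁺`. -/
  pos : Submodule ℂ V
  isClosed_pos : IsClosed (pos : Set V)

section Krein

variable (V : Type*) [NormedAddCommGroup V] [InnerProductSpace ℂ V] [CompleteSpace V]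
  [KreinSpace V]

/-- The positive part `V⁺` of a Krein space. -/
def posPart : Submodule ℂ V := KreinSpace.pos

/-- The negative part `V⁻` of a Krein space. -/
def negPart : Submodule ℂ V := (posPart V)ᗮ

instance instHasOrthogonalProjectionPosPart : (posPart V).HasOrthogonalProjection := by
  have : CompleteSpace (posPart V) :=
    (KreinSpace.isClosed_pos (V := V)).completeSpace_coe
  infer_instance

instance instHasOrthogonalProjectionNegPart : (negPart V).HasOrthogonalProjection := by
  unfold negPart; infer_instance

variable {V}

/-- The indefinite inner product `{x, y} = ⟪x⁺, y⁺⟫ - ⟪x⁻, y⁻⟫` of a Krein space; it is conjugate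
linear in `x` and linear in `y`. -/
def kip (x y : V) : ℂ :=
  inner ℂ ((posPart V).starProjection x) ((posPart V).starProjection y)
    - inner ℂ ((negPart V).starProjection x) ((negPart V).starProjection y)

/-- The continuous linear functional `{x, ·}`. -/
def kipL (x : V) : V →L[ℂ] ℂ :=
  (innerSL ℂ ((posPart V).starProjection x)).comp (posPart V).starProjection
    - (innerSL ℂ ((negPart V).starProjection x)).comp (negPart V).starProjection

theorem kipL_apply (x y : V) : kipL x y = kip x y := rfl

theorem kip_add_left (x y z : V) : kip (x + y) z = kip x z + kip y z := by
  simp only [kip, map_add, inner_add_left]; ring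

theorem kip_add_right (x y z : V) : kip x (y + z) = kip x y + kip x z := by
  simp only [kip, map_add, inner_add_right]; ring

theorem kip_smul_left (c : ℂ) (x y : V) : kip (c • x) y = conj c * kip x y := by
  simp only [kip, map_smul, inner_smul_left]; ring

theorem kip_smul_right (c : ℂ) (x y : V) : kip x (c • y) = c * kip x y := by
  simp only [kip, map_smul, inner_smul_right]; ring

theorem kip_zero_left (y : V) : kip 0 y = 0 := by simp [kip]

theorem kip_conj (x y : V) : conj (kip x y) = kip y x := by
  simp only [kip, map_sub, inner_conj_symm]

open Classical in
/-- The degree of a homogeneous vector: `0` on `V⁺`, and `1` for the other homogeneous vectors. -/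
def sig (v : V) : ℕ := if v ∈ posPart V then 0 else 1

/-- The reflection `x⁺ + x⁻ ↦ x⁺ - x⁻`. -/
def kflip (x : V) : V := (posPart V).starProjection x - (negPart V).starProjection x

theorem pos_add_neg (x : V) :
    (posPart V).starProjection x + (negPart V).starProjection x = x :=
  (posPart V).starProjection_add_starProjection_orthogonal x

theorem flip_flip (y : V) : kflip (kflip y) = y := by
  have hp := (posPart V).starProjection_apply_mem y
  have hn : (negPart V).starProjection y ∈ (posPart V)ᗮ := (negPart V).starProjection_apply_mem y
  have h1 : (posPart V).starProjection (kflip y) = (posPart V).starProjection y := by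
    refine Submodule.eq_starProjection_of_mem_orthogonal' (z := -(negPart V).starProjection y)
      hp (neg_mem hn) ?_
    rw [kflip, sub_eq_add_neg]
  have h := pos_add_neg (kflip y)
  have h2 : (negPart V).starProjection (kflip y) = kflip y - (posPart V).starProjection y := by
    rw [← h1]; exact (eq_sub_of_add_eq' h)
  rw [kflip, h1, h2, kflip]
  conv_rhs => rw [← pos_add_neg y]
  abel

theorem kip_flip_right (x y : V) : kip x (kflip y) = inner ℂ x y := by
  have hp (z : V) : (posPart V).starProjection z ∈ posPart V :=
    (posPart V).starProjection_apply_mem z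
  have hn (z : V) : (negPart V).starProjection z ∈ (posPart V)ᗮ :=
    (negPart V).starProjection_apply_mem z
  have h1 : (posPart V).starProjection (kflip y) = (posPart V).starProjection y := by
    refine Submodule.eq_starProjection_of_mem_orthogonal' (z := -(negPart V).starProjection y)
      (hp y) (neg_mem (hn y)) ?_
    rw [kflip, sub_eq_add_neg]
  have h2 : (negPart V).starProjection (kflip y) = -(negPart V).starProjection y := by
    have h := pos_add_neg (kflip y)
    rw [h1] at h
    have h' : (posPart V).starProjection y + (negPart V).starProjection (kflip y)
        = (posPart V).starProjection y - (negPart V).starProjection y := h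
    rw [sub_eq_add_neg] at h'
    exact add_left_cancel h'
  rw [kip, h1, h2, inner_neg_right, sub_neg_eq_add]
  conv_rhs => rw [← pos_add_neg x, ← pos_add_neg y]
  rw [inner_add_left, inner_add_right, inner_add_right,
    Submodule.inner_right_of_mem_orthogonal (hp x) (hn y),
    Submodule.inner_left_of_mem_orthogonal (hp y) (hn x)]
  ring

/-- A real subspace is adapted if it is the sum of its intersections with `V⁺` and `V⁻`. -/
def IsAdapted (W : Submodule ℝ V) : Prop :=
  W = (W ⊓ (posPart V).restrictScalars ℝ) ⊔ (W ⊓ (negPart V).restrictScalars ℝ)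

/-- A finite-dimensional complex Krein subspace: it inherits a decomposition from `V`. -/
def IsFinKreinSubspace (W : Submodule ℂ V) : Prop :=
  FiniteDimensional ℂ W ∧ W = (W ⊓ posPart V) ⊔ (W ⊓ negPart V)

/-- `ξ` is an orthonormal basis of the finite-dimensional Krein subspace `W`: an orthonormal basis
for the Hilbert inner product each member of which lies in the positive or negative part. -/
def IsONBasis (W : Submodule ℂ V) {d : ℕ} (ξ : Fin d → V) : Prop :=
  (∀ a, ξ a ∈ posPart V ∨ ξ a ∈ negPart V) ∧ Orthonormal ℂ ξ ∧
    Submodule.span ℂ (Set.range ξ) = W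

/-- `W = {v | ∀ w ∈ W, Im {v, w} = 0}`: Lagrangian for the imaginary part. -/
def IsLagrangian (W : Submodule ℝ V) : Prop :=
  ∀ v, v ∈ W ↔ ∀ w ∈ W, (kip v w).im = 0

/-- `W = {v | ∀ w ∈ W, Re {v, w} = 0}`: real hypermaximal neutral. -/
def IsHypermaximalNeutral (W : Submodule ℝ V) : Prop :=
  ∀ v, v ∈ W ↔ ∀ w ∈ W, (kip v w).re = 0

/-- `W` is compatible with the complex structure: `W` is the fixed point set of an involutive
adapted real anti-isometry `u` that is conjugate linear. -/
def IsCompatible (W : Submodule ℝ V) : Prop :=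
  ∃ u : V →ₗ[ℝ] V, (∀ v, u (u v) = v) ∧ (∀ v w, (kip (u v) (u w)).re = -(kip v w).re) ∧
    (∀ v ∈ posPart V, u v ∈ negPart V) ∧ (∀ v ∈ negPart V, u v ∈ posPart V) ∧
    (∀ v, v ∈ W ↔ u v = v) ∧ ∀ v, u (Complex.I • v) = -(Complex.I • u v)

end Krein

/-! ### Orthogonal direct sums -/

section Prod

variable {V₁ V₂ : Type*} [NormedAddCommGroup V₁] [InnerProductSpace ℂ V₁] [CompleteSpace V₁]
  [KreinSpace V₁] [NormedAddCommGroup V₂] [InnerProductSpace ℂ V₂] [CompleteSpace V₂]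
  [KreinSpace V₂]

/-- The orthogonal direct sum of two Krein spaces, with `(V₁ ⊕ V₂)⁺ = V₁⁺ ⊕ V₂⁺`. -/
instance instKreinSpaceProd : KreinSpace (WithLp 2 (V₁ × V₂)) where
  pos := (posPart V₁).comap (WithLp.fstL 2 ℂ V₁ V₂).toLinearMap ⊓
    (posPart V₂).comap (WithLp.sndL 2 ℂ V₁ V₂).toLinearMap
  isClosed_pos := by
    have h₁ : IsClosed ((posPart V₁ : Submodule ℂ V₁) : Set V₁) := KreinSpace.isClosed_pos
    have h₂ : IsClosed ((posPart V₂ : Submodule ℂ V₂) : Set V₂) := KreinSpace.isClosed_pos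
    exact (h₁.preimage (WithLp.fstL 2 ℂ V₁ V₂).continuous).inter
      (h₂.preimage (WithLp.sndL 2 ℂ V₁ V₂).continuous)

theorem kip_prod (x y : WithLp 2 (V₁ × V₂)) :
    kip x y = kip x.fst y.fst + kip x.snd y.snd := by
  have hp (z : WithLp 2 (V₁ × V₂)) : (posPart (WithLp 2 (V₁ × V₂))).starProjection z =
      WithLp.toLp 2 ((posPart V₁).starProjection z.fst, (posPart V₂).starProjection z.snd) := by
    refine Submodule.eq_starProjection_of_mem_orthogonal'
      (z := WithLp.toLp 2 ((negPart V₁).starProjection z.fst,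
        (negPart V₂).starProjection z.snd)) ?_ ?_ ?_
    · exact ⟨(posPart V₁).starProjection_apply_mem _, (posPart V₂).starProjection_apply_mem _⟩
    · intro w hw
      have h1 := (negPart V₁).starProjection_apply_mem z.fst w.fst hw.1
      have h2 := (negPart V₂).starProjection_apply_mem z.snd w.snd hw.2
      rw [WithLp.prod_inner_apply]
      simp [h1, h2]
    · have h1 := pos_add_neg z.fst
      have h2 := pos_add_neg z.snd
      exact WithLp.ofLp_injective 2 (Prod.ext (by simp [h1]) (by simp [h2]))
  have hn (z : WithLp 2 (V₁ × V₂)) : (negPart (WithLp 2 (V₁ × V₂))).starProjection z =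
      WithLp.toLp 2 ((negPart V₁).starProjection z.fst, (negPart V₂).starProjection z.snd) := by
    have h := pos_add_neg z
    have h1 := pos_add_neg z.fst
    have h2 := pos_add_neg z.snd
    rw [hp] at h
    refine add_left_cancel (h.trans ?_)
    exact WithLp.ofLp_injective 2 (Prod.ext (by simp [h1]) (by simp [h2]))
  simp only [kip, hp, hn, WithLp.prod_inner_apply]
  ring

/-- The embedding `η ↦ (η, 0)`. -/
def inlP (x : V₁) : WithLp 2 (V₁ × V₂) := WithLp.toLp 2 (x, 0)

/-- The embedding `ξ ↦ (0, ξ)`. -/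
def inrP (x : V₂) : WithLp 2 (V₁ × V₂) := WithLp.toLp 2 (0, x)

end Prod
/-! ### Statistics and Fock space -/

/-- The two cases: bosonic and fermionic. -/
inductive Statistics
  | boson
  | fermion

namespace Statistics

/-- `κ = 1` in the bosonic case, `κ = -1` in the fermionic case. -/
def kappa : Statistics → ℂ
  | boson => 1
  | fermion => -1

/-- `κ ^ |σ|`: `1` in the bosonic case, the sign of `σ` in the fermionic case. -/
def permSign {ι : Type*} [Fintype ι] [DecidableEq ι] (s : Statistics) (σ : Equiv.Perm ι) : ℂ :=
  match s with
  | boson => 1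
  | fermion => ((Equiv.Perm.sign σ : ℤ) : ℂ)

variable {ι : Type*} [Fintype ι] [DecidableEq ι]

theorem permSign_mul (s : Statistics) (σ τ : Equiv.Perm ι) :
    s.permSign (σ * τ) = s.permSign σ * s.permSign τ := by
  cases s <;> simp [permSign]

theorem kappa_mul_self (s : Statistics) : s.kappa * s.kappa = 1 := by
  cases s <;> simp [kappa]

theorem permSign_one (s : Statistics) : s.permSign (1 : Equiv.Perm ι) = 1 := by
  cases s <;> simp [permSign]

theorem permSign_mul_self (s : Statistics) (σ : Equiv.Perm ι) :
    s.permSign σ * s.permSign σ = 1 := by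
  cases s
  · simp [permSign]
  · rcases Int.units_eq_one_or (Equiv.Perm.sign σ) with h | h <;> simp [permSign, h]

theorem permSign_conj_rev (s : Statistics) {n : ℕ} (σ : Equiv.Perm (Fin n)) :
    s.permSign (Fin.revPerm (n := n)) * s.permSign σ * s.permSign (Fin.revPerm (n := n)) =
      s.permSign σ := by
  linear_combination s.permSign σ * s.permSign_mul_self (Fin.revPerm (n := n))

theorem permSign_inv (s : Statistics) (σ : Equiv.Perm ι) :
    s.permSign σ⁻¹ = s.permSign σ := by
  cases s <;> simp [permSign]

theorem conj_permSign (s : Statistics) (σ : Equiv.Perm ι) :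
    conj (s.permSign σ) = s.permSign σ := by
  cases s <;> simp [permSign]

end Statistics

section Fock

variable (s : Statistics) (L : Type*) [NormedAddCommGroup L] [InnerProductSpace ℂ L]

/-- `𝓕ₙ(L)`: continuous `n`-linear maps `ψ` with `ψ ∘ σ = κ^|σ| ψ` for all permutations `σ`. -/
def FockN (n : ℕ) : Submodule ℂ (ContinuousMultilinearMap ℂ (fun _ : Fin n => L) ℂ) where
  carrier := {ψ | ∀ (σ : Equiv.Perm (Fin n)) (v : Fin n → L),
    ψ (fun i => v (σ i)) = s.permSign σ * ψ v}
  add_mem' {a b} ha hb σ v := by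
    simp only [_root_.add_apply, ha σ v, hb σ v]; ring
  zero_mem' σ v := by simp
  smul_mem' c a ha σ v := by
    simp only [_root_.smul_apply, ha σ v, smul_eq_mul]; ring

/-- The algebraic Fock space `⨁ₙ 𝓕ₙ(L)`. All states on which amplitudes are defined have finite
degree, so that they lie here. -/
abbrev Fock : Type _ := DirectSum ℕ (fun n => FockN s L n)

variable {L}

/-- The (anti-)symmetrization
`(symmetrize f)(v₁, …, vₙ) = (1/n!) ∑_σ κ^|σ| f(v_σ(1), …, v_σ(n))`. -/
def symmetrize {n : ℕ} : ContinuousMultilinearMap ℂ (fun _ : Fin n => L) ℂ →ₗ[ℂ] FockN s L n where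
  toFun f := ⟨((n.factorial : ℂ)⁻¹) • ∑ σ : Equiv.Perm (Fin n), s.permSign σ • f.domDomCongr σ, by
    intro τ v
    simp only [_root_.smul_apply, _root_.sum_apply,
      ContinuousMultilinearMap.domDomCongr_apply, smul_eq_mul]
    rw [mul_left_comm]
    congr 1
    rw [Finset.mul_sum]
    refine Fintype.sum_equiv (Equiv.mulLeft τ) _ _ fun σ => ?_
    simp only [Equiv.coe_mulLeft, Equiv.Perm.mul_apply]
    rw [s.permSign_mul, ← mul_assoc, ← mul_assoc, s.permSign_mul_self, one_mul]⟩
  map_add' f g := by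
    ext v
    simp [mul_add, Finset.sum_add_distrib]
  map_smul' c f := by
    ext v
    simp [Finset.mul_sum, mul_left_comm]

theorem symm_apply {n : ℕ} (f : ContinuousMultilinearMap ℂ (fun _ : Fin n => L) ℂ)
    (v : Fin n → L) : (symmetrize s f).1 v =
      (n.factorial : ℂ)⁻¹ * ∑ σ : Equiv.Perm (Fin n), s.permSign σ * f (fun i => v (σ i)) := by
  simp [symmetrize]

theorem symm_domDomCongr {n : ℕ} (f : ContinuousMultilinearMap ℂ (fun _ : Fin n => L) ℂ)
    (τ : Equiv.Perm (Fin n)) : symmetrize s (f.domDomCongr τ) = s.permSign τ • symmetrize s f := by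
  ext v
  have h : ((s.permSign τ • symmetrize s f : FockN s L n) :
      ContinuousMultilinearMap ℂ (fun _ : Fin n => L) ℂ) v
      = s.permSign τ * (symmetrize s f).1 v := rfl
  rw [h, symm_apply, symm_apply, mul_left_comm]
  congr 1
  rw [Finset.mul_sum]
  refine Fintype.sum_equiv (Equiv.mulRight τ) _ _ fun σ => ?_
  simp only [Equiv.coe_mulRight, ContinuousMultilinearMap.domDomCongr_apply,
    Equiv.Perm.mul_apply]
  have h2 := s.permSign_mul_self τ
  rw [s.permSign_mul]
  linear_combination (-(s.permSign σ * f fun i => v (σ (τ i)))) * h2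

/-- The vacuum `𝟏 ∈ 𝓕₀`. -/
def vacuum : Fock s L :=
  DirectSum.lof ℂ ℕ (fun n => FockN s L n) 0
    ⟨ContinuousMultilinearMap.constOfIsEmpty ℂ _ 1, fun σ v => by
      rw [Subsingleton.elim σ 1, s.permSign_one]; simp⟩

variable [CompleteSpace L] [KreinSpace L]

/-- The multilinear map `(η₁, …, ηₙ) ↦ ∏ᵢ {ξᵢ, ηᵢ}`. -/
def kipProd {n : ℕ} (ξ : Fin n → L) : ContinuousMultilinearMap ℂ (fun _ : Fin n => L) ℂ :=
  (ContinuousMultilinearMap.mkPiAlgebra ℂ (Fin n) ℂ).compContinuousLinearMap fun i => kipL (ξ i)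

theorem kipProd_apply {n : ℕ} (ξ η : Fin n → L) : kipProd ξ η = ∏ i, kip (ξ i) (η i) := by
  simp [kipProd, kipL_apply]

/-- The generating state `ψ[ξ₁, …, ξₙ] ∈ 𝓕ₙ(L)`,
`ψ[ξ](η) = (1/n!) ∑_σ κ^|σ| ∏ᵢ {ξᵢ, η_σ(i)}`. -/
def csN {n : ℕ} (ξ : Fin n → L) : FockN s L n := symmetrize s (kipProd ξ)

theorem csN_apply {n : ℕ} (ξ η : Fin n → L) : (csN s ξ).1 η =
    (n.factorial : ℂ)⁻¹ *
      ∑ σ : Equiv.Perm (Fin n), s.permSign σ * ∏ i, kip (ξ i) (η (σ i)) := by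
  simp [csN, symm_apply, kipProd_apply]

/-- The generating state `ψ[ξ₁, …, ξₙ]` as an element of Fock space. -/
def cs {n : ℕ} (ξ : Fin n → L) : Fock s L := DirectSum.lof ℂ ℕ (fun n => FockN s L n) n (csN s ξ)

theorem cs_empty (ξ : Fin 0 → L) : cs s ξ = vacuum s := by
  unfold cs vacuum
  congr 1
  ext v
  rw [csN_apply]
  simp [s.permSign_one]

variable (L) in
/-- `𝓗°`: the space of linear combinations of generating states (the vacuum being `ψ[]`). -/
def genSpan : Submodule ℂ (Fock s L) :=
  Submodule.span ℂ {x | ∃ (n : ℕ) (ξ : Fin n → L), x = cs s ξ}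

theorem cs_mem {n : ℕ} (ξ : Fin n → L) : cs s ξ ∈ genSpan s L :=
  Submodule.subset_span ⟨n, ξ, rfl⟩

theorem vacuum_mem : vacuum s ∈ genSpan s L := cs_empty s (L := L) Fin.elim0 ▸ cs_mem s _

end Fock

/-! ### The maps `τ` and `ι` -/

section UpdateLemmas

variable {A B : Type*} {m n : ℕ} (g : A → B) (x : Fin (m + n) → A) (a : A)

theorem update_castAdd_castAdd (i : Fin m) :
    (fun i' => g (Function.update x (Fin.castAdd n i) a (Fin.castAdd n i'))) =
      Function.update (fun i' => g (x (Fin.castAdd n i'))) i (g a) := by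
  funext i'
  by_cases h : i' = i
  · subst h; simp
  · rw [Function.update_of_ne h,
      Function.update_of_ne fun h' => h (Fin.castAdd_injective m n h')]

theorem update_natAdd_natAdd (j : Fin n) :
    (fun j' => g (Function.update x (Fin.natAdd m j) a (Fin.natAdd m j'))) =
      Function.update (fun j' => g (x (Fin.natAdd m j'))) j (g a) := by
  funext j'
  by_cases h : j' = j
  · subst h; simp
  · rw [Function.update_of_ne h,
      Function.update_of_ne fun h' => h (Fin.natAdd_injective n m h')]

theorem update_castAdd_natAdd (i : Fin m) (j : Fin n) :
    Function.update x (Fin.castAdd n i) a (Fin.natAdd m j) = x (Fin.natAdd m j) := by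
  refine Function.update_of_ne ?_ _ _
  rw [Ne, Fin.ext_iff, Fin.val_natAdd, Fin.val_castAdd]
  have := i.isLt
  omega

theorem update_natAdd_castAdd (i : Fin m) (j : Fin n) :
    Function.update x (Fin.natAdd m j) a (Fin.castAdd n i) = x (Fin.castAdd n i) := by
  refine Function.update_of_ne ?_ _ _
  rw [Ne, Fin.ext_iff, Fin.val_natAdd, Fin.val_castAdd]
  have := i.isLt
  omega

theorem update_rev {k : ℕ} (g : A → B) (x : Fin k → A) (i : Fin k) (a : A) :
    (fun i' => g (Function.update x i a (Fin.rev i'))) =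
      Function.update (fun i' => g (x (Fin.rev i'))) i.rev (g a) := by
  funext i'
  by_cases h : i' = i.rev
  · subst h; simp
  · rw [Function.update_of_ne h, Function.update_of_ne]
    intro h'
    exact h (by rw [← h', Fin.rev_rev])

end UpdateLemmas

section Tau

variable (s : Statistics) {L₁ L₂ : Type*} [NormedAddCommGroup L₁] [InnerProductSpace ℂ L₁]
  [NormedAddCommGroup L₂] [InnerProductSpace ℂ L₂]

/-- The multilinear map
`((η₁, ξ₁), …, (η_{m+n}, ξ_{m+n})) ↦ ψ₁(η₁, …, ηₘ) ψ₂(ξ_{m+1}, …, ξ_{m+n})`. -/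
def mulSplit {m n : ℕ} (ψ₁ : ContinuousMultilinearMap ℂ (fun _ : Fin m => L₁) ℂ)
    (ψ₂ : ContinuousMultilinearMap ℂ (fun _ : Fin n => L₂) ℂ) :
    ContinuousMultilinearMap ℂ (fun _ : Fin (m + n) => WithLp 2 (L₁ × L₂)) ℂ where
  toFun x := ψ₁ (fun i => (x (Fin.castAdd n i)).fst) * ψ₂ (fun j => (x (Fin.natAdd m j)).snd)
  map_update_add' {inst} x k a b := by
    rw [Subsingleton.elim inst (instDecidableEqFin (m + n))]
    refine Fin.addCases (fun i => ?_) (fun j => ?_) k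
    · simp only [update_castAdd_castAdd WithLp.fst, update_castAdd_natAdd]
      rw [WithLp.add_fst, ψ₁.map_update_add, add_mul]
    · simp only [update_natAdd_natAdd WithLp.snd, update_natAdd_castAdd]
      rw [WithLp.add_snd, ψ₂.map_update_add, mul_add]
  map_update_smul' {inst} x k c a := by
    rw [Subsingleton.elim inst (instDecidableEqFin (m + n))]
    refine Fin.addCases (fun i => ?_) (fun j => ?_) k
    · simp only [update_castAdd_castAdd WithLp.fst, update_castAdd_natAdd]
      rw [WithLp.smul_fst, ψ₁.map_update_smul, smul_eq_mul, smul_eq_mul, mul_assoc]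
    · simp only [update_natAdd_natAdd WithLp.snd, update_natAdd_castAdd]
      rw [WithLp.smul_snd, ψ₂.map_update_smul, smul_eq_mul, smul_eq_mul, mul_left_comm]
  cont := by
    refine (ψ₁.cont.comp (continuous_pi fun i => ?_)).mul
      (ψ₂.cont.comp (continuous_pi fun j => ?_))
    · exact (WithLp.fstL 2 ℂ L₁ L₂).continuous.comp (continuous_apply _)
    · exact (WithLp.sndL 2 ℂ L₁ L₂).continuous.comp (continuous_apply _)

theorem mulSplit_apply {m n : ℕ} (ψ₁ : ContinuousMultilinearMap ℂ (fun _ : Fin m => L₁) ℂ)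
    (ψ₂ : ContinuousMultilinearMap ℂ (fun _ : Fin n => L₂) ℂ)
    (x : Fin (m + n) → WithLp 2 (L₁ × L₂)) : mulSplit ψ₁ ψ₂ x =
      ψ₁ (fun i => (x (Fin.castAdd n i)).fst) * ψ₂ (fun j => (x (Fin.natAdd m j)).snd) := rfl

/-- `τ : 𝓕ₘ(L₁) × 𝓕ₙ(L₂) → 𝓕_{m+n}(L₁ ⊕ L₂)`, given by
`(1/(m+n)!) ∑_σ κ^|σ| ψ₁(η_σ(1), …, η_σ(m)) ψ₂(ξ_σ(m+1), …, ξ_σ(m+n))`. -/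
def tauN (m n : ℕ) :
    FockN s L₁ m →ₗ[ℂ] FockN s L₂ n →ₗ[ℂ] FockN s (WithLp 2 (L₁ × L₂)) (m + n) :=
  LinearMap.mk₂ ℂ (fun ψ₁ ψ₂ => symmetrize s (mulSplit ψ₁.1 ψ₂.1))
    (fun a b c => by
      rw [← map_add]; congr 1; ext v; simp [mulSplit_apply, add_mul])
    (fun r a c => by
      rw [← map_smul]; congr 1; ext v; simp [mulSplit_apply, mul_assoc])
    (fun a b c => by
      rw [← map_add]; congr 1; ext v; simp [mulSplit_apply, mul_add])
    (fun r a c => by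
      rw [← map_smul]; congr 1; ext v; simp [mulSplit_apply, mul_left_comm])

/-- `τ : 𝓕(L₁) × 𝓕(L₂) → 𝓕(L₁ ⊕ L₂)`, as a bilinear map, extended over all degrees. -/
def tau : Fock s L₁ →ₗ[ℂ] Fock s L₂ →ₗ[ℂ] Fock s (WithLp 2 (L₁ × L₂)) :=
  DirectSum.toModule ℂ ℕ _ fun m => LinearMap.flip <| DirectSum.toModule ℂ ℕ _ fun n =>
    LinearMap.flip <| (tauN s m n).compr₂
      (DirectSum.lof ℂ ℕ (fun k => FockN s (WithLp 2 (L₁ × L₂)) k) (m + n))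

theorem tau_lof {m n : ℕ} (ψ₁ : FockN s L₁ m) (ψ₂ : FockN s L₂ n) :
    tau s (DirectSum.lof ℂ ℕ (fun k => FockN s L₁ k) m ψ₁)
      (DirectSum.lof ℂ ℕ (fun k => FockN s L₂ k) n ψ₂) =
    DirectSum.lof ℂ ℕ (fun k => FockN s (WithLp 2 (L₁ × L₂)) k) (m + n) (tauN s m n ψ₁ ψ₂) := by
  simp [tau]

/-- The block permutation of `Fin (m + n)` built from permutations of the two blocks. -/
def blockPerm {m n : ℕ} (σ : Equiv.Perm (Fin m)) (τ : Equiv.Perm (Fin n)) :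
    Equiv.Perm (Fin (m + n)) :=
  finSumFinEquiv.permCongr (Equiv.Perm.sumCongr σ τ)

theorem blockPerm_castAdd {m n : ℕ} (σ : Equiv.Perm (Fin m)) (τ : Equiv.Perm (Fin n))
    (i : Fin m) : blockPerm σ τ (Fin.castAdd n i) = Fin.castAdd n (σ i) := by
  rw [blockPerm, Equiv.permCongr_apply, finSumFinEquiv_symm_apply_castAdd,
    Equiv.Perm.sumCongr_apply, Sum.map_inl, finSumFinEquiv_apply_left]

theorem blockPerm_natAdd {m n : ℕ} (σ : Equiv.Perm (Fin m)) (τ : Equiv.Perm (Fin n))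
    (j : Fin n) : blockPerm σ τ (Fin.natAdd m j) = Fin.natAdd m (τ j) := by
  rw [blockPerm, Equiv.permCongr_apply, finSumFinEquiv_symm_apply_natAdd,
    Equiv.Perm.sumCongr_apply, Sum.map_inr, finSumFinEquiv_apply_right]

theorem permSign_blockPerm {m n : ℕ} (σ : Equiv.Perm (Fin m)) (τ : Equiv.Perm (Fin n)) :
    s.permSign (blockPerm σ τ) = s.permSign σ * s.permSign τ := by
  cases s <;> simp [Statistics.permSign, blockPerm]

theorem tauN_symm {m n : ℕ} (f : ContinuousMultilinearMap ℂ (fun _ : Fin m => L₁) ℂ)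
    (g : ContinuousMultilinearMap ℂ (fun _ : Fin n => L₂) ℂ) :
    tauN s m n (symmetrize s f) (symmetrize s g) = symmetrize s (mulSplit f g) := by
  have hm : ((m.factorial : ℂ)) ≠ 0 := by exact_mod_cast m.factorial_ne_zero
  have hn : ((n.factorial : ℂ)) ≠ 0 := by exact_mod_cast n.factorial_ne_zero
  have key : mulSplit (symmetrize s f).1 (symmetrize s g).1 = ((m.factorial : ℂ)⁻¹ * (n.factorial : ℂ)⁻¹) •
      ∑ σ : Equiv.Perm (Fin m), ∑ τ : Equiv.Perm (Fin n),
        s.permSign (blockPerm σ τ) • (mulSplit f g).domDomCongr (blockPerm σ τ) := by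
    ext v
    rw [mulSplit_apply, symm_apply, symm_apply]
    simp only [_root_.smul_apply, _root_.sum_apply,
      ContinuousMultilinearMap.domDomCongr_apply, smul_eq_mul, mulSplit_apply,
      permSign_blockPerm]
    rw [mul_mul_mul_comm, Finset.sum_mul_sum]
    congr 1
    refine Finset.sum_congr rfl fun σ _ => Finset.sum_congr rfl fun τ _ => ?_
    rw [mul_mul_mul_comm]
    have h1 (i : Fin m) := blockPerm_castAdd σ τ i
    have h2 (j : Fin n) := blockPerm_natAdd σ τ j
    congr 3
    · funext i; rw [h1]
    · funext j; rw [h2]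
  change symmetrize s (mulSplit (symmetrize s f).1 (symmetrize s g).1) = _
  rw [key, map_smul, map_sum]
  simp_rw [map_sum, map_smul, symm_domDomCongr, smul_smul, s.permSign_mul_self, one_smul]
  simp only [Finset.sum_const, Finset.card_univ, Fintype.card_perm, Fintype.card_fin]
  rw [← Nat.cast_smul_eq_nsmul ℂ, ← Nat.cast_smul_eq_nsmul ℂ, smul_smul, smul_smul]
  have h : (m.factorial : ℂ)⁻¹ * (n.factorial : ℂ)⁻¹ * (m.factorial : ℂ) * n.factorial = 1 := by
    field_simp
  rw [h, one_smul]

variable [CompleteSpace L₁] [KreinSpace L₁] [CompleteSpace L₂] [KreinSpace L₂]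

theorem tau_cs {m n : ℕ} (η : Fin m → L₁) (ξ : Fin n → L₂) :
    tau s (cs s η) (cs s ξ) =
      cs s (Fin.append (fun i => inlP (η i)) (fun j => inrP (ξ j)) :
        Fin (m + n) → WithLp 2 (L₁ × L₂)) := by
  rw [cs, cs, tau_lof, csN, csN, tauN_symm, cs, csN]
  congr 2
  ext v
  rw [mulSplit_apply, kipProd_apply, kipProd_apply, kipProd_apply, Fin.prod_univ_add]
  simp [kip_prod, inlP, inrP, kip_zero_left]

theorem tau_mem {x : Fock s L₁} {y : Fock s L₂} (hx : x ∈ genSpan s L₁)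
    (hy : y ∈ genSpan s L₂) : tau s x y ∈ genSpan s (WithLp 2 (L₁ × L₂)) := by
  have h := Submodule.apply_mem_map₂ (tau s) hx hy
  rw [genSpan, genSpan, Submodule.map₂_span_span] at h
  refine Submodule.span_le.2 ?_ h
  rintro _ ⟨_, ⟨m, η, rfl⟩, _, ⟨n, ξ, rfl⟩, rfl⟩
  change tau s (cs s η) (cs s ξ) ∈ _
  rw [tau_cs]
  exact cs_mem s _

end Tau

section Iota

variable (s : Statistics) {L L' : Type*} [NormedAddCommGroup L] [InnerProductSpace ℂ L]
  [NormedAddCommGroup L'] [InnerProductSpace ℂ L']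
  (bar : L ≃SL[starRingEnd ℂ] L')

/-- The multilinear map `(ξ₁, …, ξₙ) ↦ conj ψ(ξₙ, …, ξ₁)`, vectors of `L' = L_{Σ̄}` being
identified with vectors of `L = L_Σ` through the conjugate linear bijection `bar`. -/
def conjRev {n : ℕ} (ψ : ContinuousMultilinearMap ℂ (fun _ : Fin n => L) ℂ) :
    ContinuousMultilinearMap ℂ (fun _ : Fin n => L') ℂ where
  toFun v := conj (ψ fun i => bar.symm (v i.rev))
  map_update_add' {inst} v k a b := by
    cases Subsingleton.elim inst (instDecidableEqFin n)
    simp only [update_rev, map_add]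
    exact (congrArg conj (ψ.map_update_add _ _ _ _)).trans (map_add _ _ _)
  map_update_smul' {inst} v k c a := by
    cases Subsingleton.elim inst (instDecidableEqFin n)
    simp only [update_rev, map_smulₛₗ]
    refine (congrArg conj (ψ.map_update_smul _ _ _ _)).trans ?_
    simp
  cont := Complex.continuous_conj.comp <| ψ.cont.comp <| continuous_pi fun i =>
    bar.symm.continuous.comp (continuous_apply _)

theorem conjRev_apply {n : ℕ} (ψ : ContinuousMultilinearMap ℂ (fun _ : Fin n => L) ℂ)
    (v : Fin n → L') : conjRev bar ψ v = conj (ψ fun i => bar.symm (v i.rev)) := rfl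

/-- `ι : 𝓕ₙ(L_Σ) → 𝓕ₙ(L_{Σ̄})`, `(ι ψ)(ξ₁, …, ξₙ) = conj ψ(ξₙ, …, ξ₁)`. -/
def iotaN (n : ℕ) : FockN s L n →+ FockN s L' n where
  toFun ψ := ⟨conjRev bar ψ.1, fun σ v => by
    rw [conjRev_apply, conjRev_apply]
    have h := ψ.2 (Fin.revPerm * σ * Fin.revPerm) fun i => bar.symm (v i.rev)
    simp only [Equiv.Perm.mul_apply, Fin.revPerm_apply, Fin.rev_rev] at h
    have h2 := s.permSign_mul_self (Fin.revPerm (n := n))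
    rw [h, map_mul, s.conj_permSign, s.permSign_mul, s.permSign_mul]
    linear_combination (s.permSign σ * conj (ψ.1 fun i => bar.symm (v i.rev))) * h2⟩
  map_zero' := by ext v; simp [conjRev_apply]
  map_add' a b := by ext v; simp [conjRev_apply]

theorem iotaN_apply {n : ℕ} (ψ : FockN s L n) (v : Fin n → L') :
    (iotaN s bar n ψ).1 v = conj (ψ.1 fun i => bar.symm (v i.rev)) := rfl

/-- `ι : 𝓕(L_Σ) → 𝓕(L_{Σ̄})`, degree by degree. -/
def iota : Fock s L →+ Fock s L' := DirectSum.map fun n => iotaN s bar n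

theorem iota_smul (c : ℂ) (x : Fock s L) : iota s bar (c • x) = conj c • iota s bar x := by
  induction x using DirectSum.induction_on with
  | zero => simp
  | of n ψ =>
    rw [iota, ← DirectSum.lof_eq_of ℂ, ← map_smul, DirectSum.lof_eq_of, DirectSum.map_of,
      DirectSum.lof_eq_of, DirectSum.map_of, ← DirectSum.lof_eq_of ℂ, ← DirectSum.lof_eq_of ℂ,
      ← map_smul]
    congr 1
    ext v
    simp [iotaN_apply]
  | add x y hx hy => rw [smul_add, map_add, hx, hy, map_add, smul_add]

variable [CompleteSpace L] [KreinSpace L] [CompleteSpace L'] [KreinSpace L']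

theorem iota_cs (hbar : ∀ φ' φ, kip (bar φ') (bar φ) = s.kappa * conj (kip φ' φ))
    {n : ℕ} (ξ : Fin n → L) :
    iota s bar (cs s ξ) = s.kappa ^ n • cs s fun i => bar (ξ i.rev) := by
  rw [iota, cs, DirectSum.lof_eq_of, DirectSum.map_of, cs, ← map_smul, DirectSum.lof_eq_of]
  congr 1
  ext v
  have h : ((s.kappa ^ n • csN s fun i => bar (ξ i.rev) : FockN s L' n) :
      ContinuousMultilinearMap ℂ (fun _ : Fin n => L') ℂ) v
      = s.kappa ^ n * (csN s fun i => bar (ξ i.rev)).1 v := rfl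
  rw [h, iotaN_apply, csN_apply, csN_apply, map_mul, map_inv₀, Complex.conj_natCast]
  rw [map_sum (starRingEnd ℂ), mul_left_comm (s.kappa ^ n)]
  congr 1
  rw [Finset.mul_sum]
  refine Fintype.sum_equiv ((Equiv.mulLeft Fin.revPerm).trans (Equiv.mulRight Fin.revPerm))
    _ _ fun σ => ?_
  simp only [Equiv.trans_apply, Equiv.coe_mulLeft, Equiv.coe_mulRight, Equiv.Perm.mul_apply]
  rw [s.permSign_mul, s.permSign_mul, map_mul, s.conj_permSign, map_prod,
    s.permSign_conj_rev, mul_left_comm]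
  congr 1
  have hk : s.kappa ^ n = ∏ _i : Fin n, s.kappa := by simp
  rw [hk, ← Finset.prod_mul_distrib]
  refine Fintype.prod_equiv Fin.revPerm _ _ fun i => ?_
  have e1 : Fin.revPerm (σ (Fin.revPerm (Fin.revPerm i))) = (σ i).rev := by
    change (σ i.rev.rev).rev = _
    rw [Fin.rev_rev]
  have e2 : (Fin.revPerm i).rev = i := Fin.rev_rev i
  rw [e1, e2]
  have h3 := hbar (ξ i) (bar.symm (v (σ i).rev))
  rw [bar.apply_symm_apply] at h3
  rw [h3, ← mul_assoc, s.kappa_mul_self, one_mul]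

theorem iota_mem (hbar : ∀ φ' φ, kip (bar φ') (bar φ) = s.kappa * conj (kip φ' φ))
    {x : Fock s L} (hx : x ∈ genSpan s L) : iota s bar x ∈ genSpan s L' := by
  induction hx using Submodule.span_induction with
  | mem x h =>
    obtain ⟨n, ξ, rfl⟩ := h
    rw [iota_cs s bar hbar]
    exact Submodule.smul_mem _ _ (cs_mem s _)
  | zero => rw [map_zero]; exact Submodule.zero_mem _
  | add x y _ _ hx hy => rw [map_add]; exact Submodule.add_mem _ hx hy
  | smul c x _ hx => rw [iota_smul]; exact Submodule.smul_mem _ _ hx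

end Iota

/-! ### Amplitudes -/

theorem exists_real_projection {L : Type*} [NormedAddCommGroup L] [InnerProductSpace ℂ L]
    [CompleteSpace L] {W : Submodule ℝ L} (hc : IsClosed (W : Set L)) (ξ : L) :
    ∃ a ∈ W, ∀ w ∈ W, (inner ℂ w (ξ - a)).re = 0 := by
  let _ : InnerProductSpace ℝ L := InnerProductSpace.complexToReal
  have : CompleteSpace W := hc.completeSpace_coe
  exact ⟨W.starProjection ξ, W.starProjection_apply_mem ξ,
    fun w hw => W.sub_starProjection_mem_orthogonal ξ w hw⟩

section Amplitude

variable {L : Type*} [NormedAddCommGroup L] [InnerProductSpace ℂ L] [CompleteSpace L]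
  [KreinSpace L]

/-- The condition on the real subspace `W = L_{M̃}` of `L_{∂M}`: closed adapted Lagrangian in the
bosonic case; real hypermaximal neutral and compatible with the complex structure in the fermionic
case. -/
def IsAdmissible : Statistics → Submodule ℝ L → Prop
  | .boson, W => IsClosed (W : Set L) ∧ IsAdapted W ∧ IsLagrangian W
  | .fermion, W => IsHypermaximalNeutral W ∧ IsCompatible W

theorem IsAdapted.flip_mem {W : Submodule ℝ L} (hW : IsAdapted W) {w : L} (hw : w ∈ W) :
    kflip w ∈ W := by
  rw [hW] at hw
  obtain ⟨a, ⟨ha, ha'⟩, b, ⟨hb, hb'⟩, rfl⟩ := Submodule.mem_sup.1 hw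
  have h := pos_add_neg (a + b)
  have h1 : (posPart L).starProjection (a + b) = a :=
    Submodule.eq_starProjection_of_mem_orthogonal' ha' hb' rfl
  rw [h1] at h
  rw [kflip, h1, add_left_cancel h]
  exact W.sub_mem ha hb

/-- `L_{∂M} = L_{M̃} ⊕ J L_{M̃}`. -/
theorem existsUnique_decomp {s : Statistics} {W : Submodule ℝ L} (hW : IsAdmissible s W)
    (ξ : L) : ∃! p : L × L, p.1 ∈ W ∧ p.2 ∈ W ∧ ξ = p.1 + Complex.I • p.2 := by
  suffices h : (∃ a ∈ W, ∃ b ∈ W, ξ = a + Complex.I • b) ∧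
      ∀ a ∈ W, ∀ b ∈ W, a + Complex.I • b = 0 → a = 0 by
    obtain ⟨⟨a, ha, b, hb, rfl⟩, huniq⟩ := h
    refine ⟨(a, b), ⟨ha, hb, rfl⟩, ?_⟩
    rintro ⟨a', b'⟩ ⟨ha', hb', h'⟩
    have h1 : (a - a') + Complex.I • (b - b') = 0 := by
      rw [smul_sub]
      change a + Complex.I • b = a' + Complex.I • b' at h'
      have : a - a' + (Complex.I • b - Complex.I • b') =
        (a + Complex.I • b) - (a' + Complex.I • b') := by abel
      rw [this, h', sub_self]
    have h2 := huniq _ (W.sub_mem ha ha') _ (W.sub_mem hb hb') h1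
    rw [h2, zero_add, smul_eq_zero] at h1
    have h3 := h1.resolve_left Complex.I_ne_zero
    exact Prod.ext (sub_eq_zero.1 h2).symm (sub_eq_zero.1 h3).symm
  cases s with
  | boson =>
    obtain ⟨hc, ha, hl⟩ := hW
    constructor
    · obtain ⟨p, hp, horth⟩ := exists_real_projection hc ξ
      refine ⟨p, hp, -(Complex.I • (ξ - p)), ?_, ?_⟩
      · rw [hl]
        intro w hw
        have h1 := horth _ (ha.flip_mem hw)
        have h2 : kip (ξ - p) w = inner ℂ (ξ - p) (kflip w) := by
          rw [← kip_flip_right, flip_flip]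
        have h3 : (inner ℂ (ξ - p) (kflip w)).re = 0 := by
          rw [← inner_conj_symm, Complex.conj_re]; exact h1
        rw [← neg_smul, kip_smul_left, h2, Complex.mul_im, h3]
        simp
      · rw [smul_neg, smul_smul, Complex.I_mul_I]; simp
    · intro a haW b hbW h
      have h1 : ∀ w ∈ W, kip a w = 0 := by
        intro w hw
        apply Complex.ext
        · have h2 : a = (-Complex.I) • b := by rw [neg_smul]; exact eq_neg_of_add_eq_zero_left h
          rw [h2, kip_smul_left]
          simp [(hl b).1 hbW w hw]
        · exact (hl a).1 haW w hw
      have h2 := h1 _ (ha.flip_mem haW)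
      rwa [kip_flip_right, inner_self_eq_zero] at h2
  | fermion =>
    obtain ⟨-, u, huu, -, -, -, hu, hI⟩ := hW
    constructor
    · refine ⟨(2⁻¹ : ℝ) • (ξ + u ξ), ?_, (2⁻¹ : ℝ) • -(Complex.I • (ξ - u ξ)), ?_, ?_⟩
      · rw [hu, map_smul, map_add, huu, add_comm]
      · rw [hu, map_smul, map_neg, hI, map_sub, huu, neg_neg, ← smul_neg, neg_sub]
      · rw [smul_comm Complex.I, smul_neg, smul_smul, Complex.I_mul_I, ← smul_add]
        have : ξ + u ξ + -((-1 : ℂ) • (ξ - u ξ)) = (2 : ℝ) • ξ := by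
          rw [neg_smul, one_smul, neg_neg, two_smul]; abel
        rw [this, smul_smul]; norm_num
    · intro a haW b hbW h
      have h1 := congrArg u h
      rw [map_add, hI, (hu a).1 haW, (hu b).1 hbW, map_zero] at h1
      have h2 : (2 : ℝ) • a = 0 := by
        rw [two_smul]
        calc a + a = (a + Complex.I • b) + (a + -(Complex.I • b)) := by abel
          _ = 0 := by rw [h, h1, add_zero]
      exact (smul_eq_zero.1 h2).resolve_left two_ne_zero

variable {s : Statistics} {W : Submodule ℝ L} (hW : IsAdmissible s W)

/-- `ξ^R`, where `ξ = ξ^R + J ξ^I` with `ξ^R, ξ^I ∈ W`. -/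
def rePart (ξ : L) : L := (existsUnique_decomp hW ξ).choose.1

/-- `ξ^I`, where `ξ = ξ^R + J ξ^I` with `ξ^R, ξ^I ∈ W`. -/
def imPart (ξ : L) : L := (existsUnique_decomp hW ξ).choose.2

theorem rePart_mem (ξ : L) : rePart hW ξ ∈ W := (existsUnique_decomp hW ξ).choose_spec.1.1

theorem imPart_mem (ξ : L) : imPart hW ξ ∈ W := (existsUnique_decomp hW ξ).choose_spec.1.2.1

theorem rePart_add_imPart (ξ : L) : ξ = rePart hW ξ + Complex.I • imPart hW ξ :=
  (existsUnique_decomp hW ξ).choose_spec.1.2.2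

theorem parts_eq {ξ a b : L} (ha : a ∈ W) (hb : b ∈ W) (h : ξ = a + Complex.I • b) :
    rePart hW ξ = a ∧ imPart hW ξ = b := by
  have h1 := (existsUnique_decomp hW ξ).choose_spec.2 (a, b) ⟨ha, hb, h⟩
  exact ⟨(congrArg Prod.fst h1).symm, (congrArg Prod.snd h1).symm⟩

/-- `ξ̂ = ξ^R - i ξ^I` in the complexification of `L`; the pair `(a, b)` stands for `a + i b`. -/
def hat (ξ : L) : L × L := (rePart hW ξ, -imPart hW ξ)

/-- The complex bilinear extension of the real bilinear form `{·, ·}` to the complexification: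
`{a + i b, c + i d} = {a, c} + i {a, d} + i {b, c} - {b, d}`. -/
def kipExt (x y : L × L) : ℂ :=
  kip x.1 y.1 + Complex.I * kip x.1 y.2 + Complex.I * kip x.2 y.1 - kip x.2 y.2

/-- `{ξ̂, η̂}`. -/
def pairing (ξ η : L) : ℂ := kipExt (hat hW ξ) (hat hW η)

/-- The embedding of `{0, …, ⌊N/2⌋ - 1}` in `{0, …, N - 1}`. -/
def half {N : ℕ} (j : Fin (N / 2)) : Fin N := Fin.castLE (Nat.div_le_self N 2) j

/-- The value of the amplitude on `ψ[ξ₁, …, ξ_N]`: zero for odd `N`, and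
`(1/n!) ∑_σ κ^|σ| ∏_{j = 1}^n {ξ̂_σ(j), ξ̂_σ(2n + 1 - j)}` for `N = 2n`. -/
def amplitudeValue {N : ℕ} (ξ : Fin N → L) : ℂ :=
  if Even N then
    ((N / 2).factorial : ℂ)⁻¹ * ∑ σ : Equiv.Perm (Fin N), s.permSign σ *
      ∏ j : Fin (N / 2), pairing hW (ξ (σ (half j))) (ξ (σ (half j).rev))
  else 0

theorem parts_add (ξ η : L) : rePart hW (ξ + η) = rePart hW ξ + rePart hW η ∧
    imPart hW (ξ + η) = imPart hW ξ + imPart hW η := by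
  refine parts_eq hW (W.add_mem (rePart_mem hW _) (rePart_mem hW _))
    (W.add_mem (imPart_mem hW _) (imPart_mem hW _)) ?_
  conv_lhs => rw [rePart_add_imPart hW ξ, rePart_add_imPart hW η]
  rw [smul_add]; abel

theorem parts_smul (c : ℂ) (ξ : L) :
    rePart hW (c • ξ) = (c.re : ℂ) • rePart hW ξ - (c.im : ℂ) • imPart hW ξ ∧
    imPart hW (c • ξ) = (c.im : ℂ) • rePart hW ξ + (c.re : ℂ) • imPart hW ξ := by
  have hs (r : ℝ) {w : L} (hw : w ∈ W) : (r : ℂ) • w ∈ W := by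
    have := W.smul_mem r hw
    rwa [← Complex.coe_smul] at this
  refine parts_eq hW (W.sub_mem (hs _ (rePart_mem hW _)) (hs _ (imPart_mem hW _)))
    (W.add_mem (hs _ (rePart_mem hW _)) (hs _ (imPart_mem hW _))) ?_
  conv_lhs => rw [rePart_add_imPart hW ξ]
  rw [smul_add, smul_add, smul_smul, smul_smul, smul_smul]
  have h1 : c * Complex.I = -(c.im : ℂ) + Complex.I * c.re := by
    apply Complex.ext <;> simp
  have h2 : c • rePart hW ξ = (c.re : ℂ) • rePart hW ξ + (Complex.I * c.im) • rePart hW ξ := by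
    rw [← add_smul]; congr 1; apply Complex.ext <;> simp
  rw [h1, h2, add_smul, neg_smul]; abel

theorem kip_sub_left (x y z : L) : kip (x - y) z = kip x z - kip y z := by
  simp only [kip, map_sub, inner_sub_left]; ring

theorem kip_sub_right (x y z : L) : kip x (y - z) = kip x y - kip x z := by
  simp only [kip, map_sub, inner_sub_right]; ring

theorem kip_neg_left (x y : L) : kip (-x) y = -kip x y := by
  simp only [kip, map_neg, inner_neg_left]; ring

theorem kip_neg_right (x y : L) : kip x (-y) = -kip x y := by
  simp only [kip, map_neg, inner_neg_right]; ring

theorem pairing_eq (ξ η : L) : pairing hW ξ η =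
    kip (rePart hW ξ) (rePart hW η) - Complex.I * kip (rePart hW ξ) (imPart hW η)
      - Complex.I * kip (imPart hW ξ) (rePart hW η) - kip (imPart hW ξ) (imPart hW η) := by
  simp only [pairing, kipExt, hat, kip_neg_left, kip_neg_right]; ring

/-- `{ξ̂, η̂}` as a conjugate bilinear map. -/
def pairingL : L →ₗ⋆[ℂ] L →ₗ⋆[ℂ] ℂ :=
  LinearMap.mk₂'ₛₗ (starRingEnd ℂ) (starRingEnd ℂ) (pairing hW)
    (fun x y z => by
      simp only [pairing_eq, (parts_add hW x y).1, (parts_add hW x y).2, kip_add_left]; ring)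
    (fun c x z => by
      simp only [pairing_eq, (parts_smul hW c x).1, (parts_smul hW c x).2, kip_add_left,
        kip_sub_left, kip_smul_left, Complex.conj_ofReal, smul_eq_mul]
      have hc : conj c = c.re - Complex.I * c.im := by apply Complex.ext <;> simp
      rw [hc]
      linear_combination (-c.im * (kip (imPart hW x) (rePart hW z))
        - c.im * kip (rePart hW x) (imPart hW z)) * Complex.I_mul_I)
    (fun x y z => by
      simp only [pairing_eq, (parts_add hW y z).1, (parts_add hW y z).2, kip_add_right]; ring)
    (fun c x z => by
      simp only [pairing_eq, (parts_smul hW c z).1, (parts_smul hW c z).2, kip_add_right,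
        kip_sub_right, kip_smul_right, smul_eq_mul]
      have hc : conj c = c.re - Complex.I * c.im := by apply Complex.ext <;> simp
      rw [hc]
      linear_combination (-c.im * (kip (rePart hW x) (imPart hW z))
        - c.im * kip (imPart hW x) (rePart hW z)) * Complex.I_mul_I)

theorem pairingL_apply (ξ η : L) : pairingL hW ξ η = pairing hW ξ η := rfl

theorem amplitudeValue_perm {N : ℕ} (ξ : Fin N → L) (τ : Equiv.Perm (Fin N)) :
    amplitudeValue hW (fun i => ξ (τ i)) = s.permSign τ * amplitudeValue hW ξ := by
  unfold amplitudeValue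
  split_ifs with h
  · rw [mul_left_comm]
    congr 1
    rw [Finset.mul_sum]
    refine Fintype.sum_equiv (Equiv.mulLeft τ) _ _ fun σ => ?_
    simp only [Equiv.coe_mulLeft, Equiv.Perm.mul_apply]
    rw [s.permSign_mul, ← mul_assoc, ← mul_assoc, s.permSign_mul_self, one_mul]
  · simp

theorem prod_pair_expand {n N d : ℕ} (e : Fin n ⊕ Fin n ≃ Fin N) (y : Fin N → Fin d → ℂ)
    (c : Fin d → Fin d → ℂ) :
    ∏ j, ∑ p, ∑ q, y (e (.inl j)) p * y (e (.inr j)) q * c p q =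
      ∑ J : Fin N → Fin d, (∏ i, y i (J i)) * ∏ j, c (J (e (.inl j))) (J (e (.inr j))) := by
  simp_rw [← Fintype.sum_prod_type']
  rw [Finset.prod_univ_sum, Fintype.piFinset_univ]
  let E : (Fin n → Fin d × Fin d) ≃ (Fin N → Fin d) :=
    (Equiv.arrowProdEquivProdArrow (Fin n) (fun _ => Fin d) (fun _ => Fin d)).trans
      ((Equiv.sumArrowEquivProdArrow (Fin n) (Fin n) (Fin d)).symm.trans
        (Equiv.arrowCongr e (Equiv.refl _)))
  refine Fintype.sum_equiv E _ _ fun K => ?_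
  have h1 (j : Fin n) : E K (e (.inl j)) = (K j).1 := by simp [E, Equiv.arrowCongr]
  have h2 (j : Fin n) : E K (e (.inr j)) = (K j).2 := by simp [E, Equiv.arrowCongr]
  rw [← e.prod_comp, Fintype.prod_sum_type, ← Finset.prod_mul_distrib, ← Finset.prod_mul_distrib]
  refine Finset.prod_congr rfl fun j _ => ?_
  rw [h1, h2]

theorem half_sum_bijective {N : ℕ} (hN : Even N) :
    Function.Bijective (Sum.elim half fun j => (half j).rev :
      Fin (N / 2) ⊕ Fin (N / 2) → Fin N) := by
  rw [Fintype.bijective_iff_injective_and_card]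
  obtain ⟨k, rfl⟩ := hN
  constructor
  · rintro (i | i) (j | j) h <;> simp only [Sum.elim_inl, Sum.elim_inr, half, Fin.ext_iff,
      Fin.val_castLE, Fin.val_rev] at h <;>
      have hi := i.isLt <;> have hj := j.isLt <;> first | (congr 1; ext; omega) | (exfalso; omega)
  · simp; omega

theorem amplitudeValue_expand {N d : ℕ} (b : Fin d → L) (y : Fin N → Fin d → ℂ) :
    amplitudeValue hW (fun i => ∑ p, conj (y i p) • b p) =
      ∑ J : Fin N → Fin d, (∏ i, y i (J i)) * amplitudeValue hW (fun i => b (J i)) := by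
  unfold amplitudeValue
  split_ifs with h
  · simp_rw [mul_left_comm (∏ i, y i _), ← Finset.mul_sum (a := ((N / 2).factorial : ℂ)⁻¹)]
    congr 1
    simp_rw [Finset.mul_sum]
    rw [Finset.sum_comm]
    refine Finset.sum_congr rfl fun σ _ => ?_
    simp_rw [mul_left_comm (∏ i, y i _), ← Finset.mul_sum]
    congr 1
    have h1 := prod_pair_expand ((Equiv.ofBijective _ (half_sum_bijective h)).trans σ) y
      fun p q => pairing hW (b p) (b q)
    simp only [Equiv.trans_apply, Equiv.ofBijective_apply, Sum.elim_inl, Sum.elim_inr] at h1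
    rw [← h1]
    refine Finset.prod_congr rfl fun j _ => ?_
    rw [← pairingL_apply, map_sum (pairingL hW), LinearMap.sum_apply]
    refine Finset.sum_congr rfl fun p _ => ?_
    rw [map_sum]
    refine Finset.sum_congr rfl fun q _ => ?_
    rw [map_smulₛₗ, LinearMap.map_smulₛₗ, LinearMap.smul_apply, pairingL_apply]
    simp only [Complex.conj_conj, smul_eq_mul]
    ring
  · simp

/-- The functional `ψ ↦ ∑_J ψ(b̌_{J₁}, …, b̌_{J_N}) ρ(ψ[b_{J₁}, …, b_{J_N}])`, which agrees with the
amplitude on generating states of vectors in the span of the orthonormal family `b`. -/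
def finAmplitude {d : ℕ} (b : Fin d → L) : Fock s L →ₗ[ℂ] ℂ :=
  DirectSum.toModule ℂ ℕ _ fun N =>
    { toFun := fun ψ => ∑ J : Fin N → Fin d,
        ψ.1 (fun i => kflip (b (J i))) * amplitudeValue hW (fun i => b (J i))
      map_add' := fun x y => by simp [add_mul, Finset.sum_add_distrib]
      map_smul' := fun c x => by simp [Finset.mul_sum, mul_assoc] }

theorem finAmplitude_cs {N d : ℕ} (b : Fin d → L) (hb : Orthonormal ℂ b) (ξ : Fin N → L)
    (hξ : ∀ i, ξ i ∈ Submodule.span ℂ (Set.range b)) :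
    finAmplitude hW b (cs s ξ) = amplitudeValue hW ξ := by
  have h0 : (fun i => ∑ p, conj (inner ℂ (ξ i) (b p)) • b p) = ξ := by
    funext i
    obtain ⟨c, hc⟩ := (Submodule.mem_span_range_iff_exists_fun ℂ).1 (hξ i)
    conv_rhs => rw [← hc]
    refine Finset.sum_congr rfl fun p _ => ?_
    rw [inner_conj_symm, ← hc, hb.inner_right_fintype]
  have h1 := amplitudeValue_expand hW b fun i p => inner ℂ (ξ i) (b p)
  rw [h0] at h1
  rw [h1, cs, finAmplitude, DirectSum.toModule_lof]
  simp only [LinearMap.coe_mk, AddHom.coe_mk, csN_apply, kip_flip_right]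
  have h2 (σ : Equiv.Perm (Fin N)) : ∑ J : Fin N → Fin d,
      (s.permSign σ * ∏ i, inner ℂ (ξ i) (b (J (σ i)))) * amplitudeValue hW (fun i => b (J i)) =
      ∑ J : Fin N → Fin d, (∏ i, inner ℂ (ξ i) (b (J i))) *
        amplitudeValue hW (fun i => b (J i)) := by
    refine Fintype.sum_equiv (Equiv.arrowCongr σ.symm (Equiv.refl _)) _ _ fun J => ?_
    have h3 (i : Fin N) : (Equiv.arrowCongr σ.symm (Equiv.refl (Fin d))) J i = J (σ i) := by
      simp [Equiv.arrowCongr]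
    simp only [h3]
    rw [amplitudeValue_perm hW (fun i => b (J i)) σ]
    ring
  simp_rw [mul_assoc, ← Finset.mul_sum, Finset.sum_mul]
  rw [Finset.sum_comm]
  simp_rw [h2]
  rw [Finset.sum_const, Finset.card_univ, Fintype.card_perm, Fintype.card_fin, nsmul_eq_mul,
    ← mul_assoc, inv_mul_cancel₀ (by exact_mod_cast N.factorial_ne_zero), one_mul]

theorem exists_amplitude : ∃ ρ : genSpan s L →ₗ[ℂ] ℂ,
    ∀ (n : ℕ) (ξ : Fin n → L), ρ ⟨cs s ξ, cs_mem s ξ⟩ = amplitudeValue hW ξ := by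
  let G : Submodule ℂ (Fock s L × ℂ) := Submodule.span ℂ
    {z | ∃ (n : ℕ) (ξ : Fin n → L), z = (cs s ξ, amplitudeValue hW ξ)}
  have hG : ∀ z ∈ G, ∃ F : Submodule ℂ L, F.FG ∧ ∀ T : Fock s L →ₗ[ℂ] ℂ,
      (∀ (n : ℕ) (ξ : Fin n → L), (∀ i, ξ i ∈ F) → T (cs s ξ) = amplitudeValue hW ξ) →
        T z.1 = z.2 := by
    intro z hz
    induction hz using Submodule.span_induction with
    | mem z h =>
      obtain ⟨n, ξ, rfl⟩ := h
      exact ⟨Submodule.span ℂ (Set.range ξ), Submodule.fg_span (Set.finite_range ξ),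
        fun T hT => hT n ξ fun i => Submodule.subset_span ⟨i, rfl⟩⟩
    | zero => exact ⟨⊥, Submodule.fg_bot, fun T _ => map_zero T⟩
    | add x y _ _ hx hy =>
      obtain ⟨F₁, h₁, H₁⟩ := hx
      obtain ⟨F₂, h₂, H₂⟩ := hy
      refine ⟨F₁ ⊔ F₂, h₁.sup h₂, fun T hT => ?_⟩
      rw [Prod.fst_add, Prod.snd_add, map_add,
        H₁ T fun n ξ h => hT n ξ fun i => Submodule.mem_sup_left (h i),
        H₂ T fun n ξ h => hT n ξ fun i => Submodule.mem_sup_right (h i)]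
    | smul c x _ hx =>
      obtain ⟨F, h, H⟩ := hx
      refine ⟨F, h, fun T hT => ?_⟩
      rw [Prod.smul_fst, Prod.smul_snd, map_smul, H T hT]
  have hT : ∀ F : Submodule ℂ L, F.FG → ∃ T : Fock s L →ₗ[ℂ] ℂ,
      ∀ (n : ℕ) (ξ : Fin n → L), (∀ i, ξ i ∈ F) → T (cs s ξ) = amplitudeValue hW ξ := by
    intro F hF
    have : FiniteDimensional ℂ F := Module.Finite.iff_fg.2 hF
    let e := stdOrthonormalBasis ℂ F
    refine ⟨finAmplitude hW fun i => (e i : L), fun n ξ hξ => ?_⟩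
    refine finAmplitude_cs hW _ (e.orthonormal.comp_linearIsometry F.subtypeₗᵢ) ξ fun i => ?_
    have h1 : (ξ i) = F.subtype ⟨ξ i, hξ i⟩ := rfl
    have h2 : Set.range (fun i => (e i : L)) = F.subtype '' Set.range e := by
      rw [← Set.range_comp]; rfl
    change _ ∈ Submodule.span ℂ (Set.range fun i => (e i : L))
    rw [h1, h2, ← Submodule.map_span]
    refine Submodule.mem_map_of_mem ?_
    rw [← OrthonormalBasis.coe_toBasis, e.toBasis.span_eq]
    trivial
  have hdom : genSpan s L = G.map (LinearMap.fst ℂ (Fock s L) ℂ) := by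
    rw [Submodule.map_span, genSpan]
    congr 1
    ext x
    constructor
    · rintro ⟨n, ξ, rfl⟩
      exact ⟨_, ⟨n, ξ, rfl⟩, rfl⟩
    · rintro ⟨_, ⟨n, ξ, rfl⟩, rfl⟩
      exact ⟨n, ξ, rfl⟩
  have hex : ∀ x : genSpan s L, ∃ c : ℂ, ((x : Fock s L), c) ∈ G := by
    rintro ⟨x, hx⟩
    rw [hdom] at hx
    obtain ⟨⟨_, c⟩, hc, rfl⟩ := hx
    exact ⟨c, hc⟩
  have huniq : ∀ (x : Fock s L) (c c' : ℂ), (x, c) ∈ G → (x, c') ∈ G → c = c' := by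
    intro x c c' h h'
    obtain ⟨F, hF, H⟩ := hG _ h
    obtain ⟨F', hF', H'⟩ := hG _ h'
    obtain ⟨T, hT⟩ := hT _ (hF.sup hF')
    have e1 : T x = c := H T fun n ξ h => hT n ξ fun i => Submodule.mem_sup_left (h i)
    have e2 : T x = c' := H' T fun n ξ h => hT n ξ fun i => Submodule.mem_sup_right (h i)
    rw [← e1, e2]
  choose f hf using hex
  exact ⟨{ toFun := f
           map_add' := fun x y => huniq _ _ _ (hf (x + y)) (G.add_mem (hf x) (hf y))
           map_smul' := fun c x => huniq _ _ _ (hf (c • x)) (G.smul_mem c (hf x)) },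
    fun n ξ => huniq _ _ _ (hf _) (Submodule.subset_span ⟨n, ξ, rfl⟩)⟩

/-- The amplitude map `ρ_M : 𝓗° → ℂ`: the linear map with the prescribed values on generating
states. -/
def amplitude : genSpan s L →ₗ[ℂ] ℂ := (exists_amplitude hW).choose

theorem amplitude_cs {n : ℕ} (ξ : Fin n → L) :
    amplitude hW ⟨cs s ξ, cs_mem s ξ⟩ = amplitudeValue hW ξ :=
  (exists_amplitude hW).choose_spec n ξ

end Amplitude

/-! ### Gluing along a hypersurface -/

section Gluing

variable (s : Statistics)
  (L₁ : Type*) [NormedAddCommGroup L₁] [InnerProductSpace ℂ L₁] [CompleteSpace L₁] [KreinSpace L₁]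
  (LS : Type*) [NormedAddCommGroup LS] [InnerProductSpace ℂ LS] [CompleteSpace LS] [KreinSpace LS]
  (LS' : Type*) [NormedAddCommGroup LS'] [InnerProductSpace ℂ LS'] [CompleteSpace LS']
  [KreinSpace LS']

/-- `L_{∂M} = L_{Σ₁} ⊕ L_Σ ⊕ L_{Σ̄'}` for `∂M = Σ₁ ∪ Σ ∪ Σ̄'`. -/
abbrev Boundary : Type _ := WithLp 2 (WithLp 2 (L₁ × LS) × LS')

variable {L₁ LS LS'} in
/-- The element `(x, y, z)` of `L_{Σ₁} ⊕ L_Σ ⊕ L_{Σ̄'}`. -/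
def triple (x : L₁) (y : LS) (z : LS') : Boundary L₁ LS LS' :=
  WithLp.toLp 2 (WithLp.toLp 2 (x, y), z)

/-- The classical data of a gluing: a region `M` with boundary `∂M = Σ₁ ∪ Σ ∪ Σ̄'`, where `Σ'` is a
copy of `Σ`, and the region `M₁` with `∂M₁ = Σ₁` obtained by gluing `M` to itself along `Σ`, `Σ̄'`.
The Krein spaces of `Σ₁`, `Σ`, `Σ̄'` are `L₁`, `LS`, `LS'`, and the real vector spaces of solutions
in `M` and `M₁` are `LM` and `LM₁`. -/
structure Gluing (LM LM₁ : Type*) [AddCommGroup LM] [Module ℝ LM] [AddCommGroup LM₁]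
    [Module ℝ LM₁] where
  /-- Orientation reversal `L_Σ → L_{Σ̄}`, a conjugate linear bijection. -/
  bar : LS ≃SL[starRingEnd ℂ] LS'
  kip_bar : ∀ φ' φ : LS, kip (bar φ') (bar φ) = s.kappa * conj (kip φ' φ)
  /-- `r_M : L_M → L_{∂M}`. -/
  rM : LM →ₗ[ℝ] Boundary L₁ LS LS'
  admissible : IsAdmissible s (LinearMap.range rM)
  /-- `r_{M₁} : L_{M₁} → L_{∂M₁}`. -/
  rM₁ : LM₁ →ₗ[ℝ] L₁
  admissible₁ : IsAdmissible s (LinearMap.range rM₁)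
  /-- The injection `L_{M₁} ↪ L_M`. -/
  incl : LM₁ →ₗ[ℝ] LM
  incl_injective : Function.Injective incl
  /-- `L_{M₁} ↪ L_M ⇉ L_Σ` is exact: `L_{M₁}` is the equalizer of the two maps `L_M → L_Σ`. -/
  exact : ∀ x : LM, x ∈ LinearMap.range incl ↔ (rM x).fst.snd = bar.symm (rM x).snd
  /-- `r_{M₁}` is `r_M` on `L_{M₁}` followed by the projection onto `L_{Σ₁}`. -/
  comm : ∀ x : LM₁, rM₁ x = (rM (incl x)).fst.fst

namespace Gluing

variable {s L₁ LS LS'} {LM LM₁ : Type*} [AddCommGroup LM] [Module ℝ LM] [AddCommGroup LM₁]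
  [Module ℝ LM₁] (G : Gluing s L₁ LS LS' LM LM₁)

/-- `τ(ψ ⊗ ζ ⊗ ι(ζ))`, an element of `𝓗°_{∂M}` for `ψ ∈ 𝓗°_{∂M₁}` and `ζ ∈ 𝓗°_Σ`. -/
def state (ψ : genSpan s L₁) (ζ : genSpan s LS) : genSpan s (Boundary L₁ LS LS') :=
  ⟨tau s (tau s (ψ : Fock s L₁) (ζ : Fock s LS)) (iota s G.bar (ζ : Fock s LS)),
    tau_mem s (tau_mem s ψ.2 ζ.2) (iota_mem s G.bar G.kip_bar ζ.2)⟩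

/-- The `m`-th term
`1/(2^m m!) ∑_{a₁, …, aₘ} (-1)^{∑ᵢ [ξ_{aᵢ}]} ρ_M(τ(ψ ⊗ ψ[ξ_{a₁}, …, ξ_{aₘ}] ⊗ ι(ψ[ξ_{a₁}, …, ξ_{aₘ}])))`. -/
def term (ψ : genSpan s L₁) {d : ℕ} (ξ : Fin d → LS) (m : ℕ) : ℂ :=
  1 / (2 ^ m * (m.factorial : ℂ)) * ∑ a : Fin m → Fin d, (-1) ^ (∑ i, sig (ξ (a i))) *
    amplitude G.admissible (G.state ψ ⟨cs s fun i => ξ (a i), cs_mem s _⟩)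

/-- The restricted gluing anomaly factor `c_α` of the finite-dimensional Krein subspace `A` is well
defined with value `c`: for an orthonormal basis `η` of `A`, the series with terms
`1/(2^m m!) ∑_a (-1)^{…} ρ_M(τ(𝟏 ⊗ ψ[η_a] ⊗ ι(ψ[η_a])))` converges absolutely, with sum `c`. -/
def IsRestrictedAnomaly (A : Submodule ℂ LS) (c : ℂ) : Prop :=
  ∃ (d : ℕ) (η : Fin d → LS), IsONBasis A η ∧
    Summable (fun m => ‖G.term ⟨vacuum s, vacuum_mem s⟩ η m‖) ∧
    ∑' m, G.term ⟨vacuum s, vacuum_mem s⟩ η m = c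

end Gluing

end Gluing

end GBF

end

open GBF

open scoped ComplexConjugate

noncomputable section

/-! The amplitude of a generating state is a Wick sum: each pairing of its vectors contributes 2 to
the number of pairs, times a statistics sign, times a product of values of `pairing`
(`amplitudeValue_eq_wick`). Such sums are determined by contracting the first vector with each of
the others (`wick_cons`). The terms `T_m` are therefore Wick sums on `(φ_i, 0, 0)` and `m` inserted
pairs `x_a = (0, ξ_a, 0)`, `y_a = (0, 0, ξ̄_a)` with weights `c_a = κ (-1)^[ξ_a]`
(`Gluing.term_cs`).

Let `P_l(X)` be the power series whose coefficients are these terms for a list `l`. Contracting its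
first vector `v` gives `P_{v::l} = 2 ∑ ± B(v, w) P_{l∖w} + X ∑_i k_i(v) P_{z_i::l}`, where `z_i`
runs over the `x_a` and `y_a` (`insertSeries_cons`): a contraction with an inserted vector uses up
one insertion and leaves its partner. Apply this to `v_j = (φ_j, φ̃_j, conjugate of φ̃_j)`. As `v_j`
lies in `L_M̃`, its pairing with any vector is a value of the Krein product, and the expansion of
`φ̃_j` in the basis `ξ` yields `v_j = u_j + ∑ conj(k_i(v_j)) z_i` with `u_j = (φ_j, 0, 0)`
(`Gluing.triple_eq_add_sum`). Since `P` is conjugate linear in its first vector, `P_{u_j::l} = 2 ∑ ±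
B(v_j, w) P_{l∖w} + (X - 1) D` with `D = ∑ k_i(v_j) P_{z_i::l}`. If `D` converges absolutely at `X =
1`, the last summand telescopes to zero there. As `B(v_j, u_k)` is the pairing of `φ_j` and `φ_k`
for `M₁`, what remains is the Wick recursion for `ρ_{M₁}`, starting from `P_[](1) = c_α`
(`hasSum_insertTerm`).

The analytic point is the convergence of `D`. For fermions all the series are polynomials, by
antisymmetry. For bosons, let `N` be the matrix of contractions among inserted vectors. Then `(1 -
XN)` times the vector `P_{z_i::l}` involves only shorter lists, and the Gaussian identity `det(1 -
XN) P_[]² = 1` (`det_mul_insertSeries_sq`) makes `P_[]²` times the adjugate an inverse of `1 - XN`.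
Hence every `P_l` is a polynomial in `X` and `P_[]`, and absolute convergence of `P_[]` suffices.
Finally, the terms see the inserted pairs only through `∑ c_a x_a ⊗ y_a`, which is independent of
the orthonormal basis, so the basis that defines `c_α` may be exchanged for `ξ`. -/

namespace GBF

/-! ### Signed sums over the choice of an element of a list -/

section Pick

variable {α β E E' : Type*} [AddCommGroup E] [Module ℂ E] [AddCommGroup E'] [Module ℂ E']

/-- `∑ᵢ κ ^ i Φ(lᵢ, l ∖ lᵢ)`: the signed sum over all ways to choose an element of the list `l`. -/
def pick (κ : ℂ) (Φ : α → List α → E) (l : List α) : E :=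
  ∑ i : Fin l.length, κ ^ (i : ℕ) • Φ (l.get i) (l.eraseIdx i)

variable (κ : ℂ)

theorem pick_nil (Φ : α → List α → E) : pick κ Φ [] = 0 := by simp [pick]

theorem pick_cons (Φ : α → List α → E) (v : α) (l : List α) :
    pick κ Φ (v :: l) = Φ v l + κ • pick κ (fun w l' => Φ w (v :: l')) l := by
  simp only [pick, Finset.smul_sum, smul_smul]
  refine (Fin.sum_univ_succ (n := l.length) _).trans ?_
  simp [pow_succ']

theorem pick_congr {Φ Ψ : α → List α → E} {l : List α}
    (h : ∀ w l', l'.length + 1 = l.length → Φ w l' = Ψ w l') : pick κ Φ l = pick κ Ψ l := by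
  refine Finset.sum_congr rfl fun i _ => ?_
  rw [h]
  rw [List.length_eraseIdx_of_lt i.2]
  have := i.2
  omega

theorem pick_mem (S : Submodule ℂ E) {Φ : α → List α → E} {l : List α}
    (h : ∀ w l', l'.length + 1 = l.length → Φ w l' ∈ S) : pick κ Φ l ∈ S := by
  refine S.sum_mem fun i _ => S.smul_mem _ (h _ _ ?_)
  rw [List.length_eraseIdx_of_lt i.2]
  have := i.2
  omega

theorem pick_add (Φ Ψ : α → List α → E) (l : List α) :
    pick κ (fun w l' => Φ w l' + Ψ w l') l = pick κ Φ l + pick κ Ψ l := by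
  simp [pick, Finset.sum_add_distrib]

theorem map_pick (f : E →ₗ[ℂ] E') (Φ : α → List α → E) (l : List α) :
    f (pick κ Φ l) = pick κ (fun w l' => f (Φ w l')) l := by
  simp [pick]

theorem pick_smul (c : ℂ) (Φ : α → List α → E) (l : List α) :
    pick κ (fun w l' => c • Φ w l') l = c • pick κ Φ l :=
  (map_pick κ (LinearMap.lsmul ℂ E c) Φ l).symm

theorem pick_mul (c : ℂ) (Φ : α → List α → ℂ) (l : List α) :
    pick κ (fun w l' => c * Φ w l') l = c * pick κ Φ l := pick_smul κ c Φ l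

theorem pick_mul_fun (c : ℂ) (Φ : α → List α → ℂ) :
    pick κ (fun w l' => c * Φ w l') = fun l => c * pick κ Φ l := funext fun l => pick_mul κ c Φ l

theorem pick_sum {ι : Type*} (t : Finset ι) (Φ : ι → α → List α → E) (l : List α) :
    pick κ (fun w l' => ∑ a ∈ t, Φ a w l') l = ∑ a ∈ t, pick κ (Φ a) l := by
  simp only [pick, Finset.smul_sum]
  exact Finset.sum_comm

theorem pick_map (f : β → α) (Φ : α → List α → E) (l : List β) :
    pick κ Φ (l.map f) = pick κ (fun w l' => Φ (f w) (l'.map f)) l := by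
  induction l generalizing Φ with
  | nil => simp [pick_nil]
  | cons v l ih => rw [List.map_cons, pick_cons, pick_cons, ih]; rfl

theorem pick_ofFn {n : ℕ} (Φ : α → List α → E) (ξ : Fin (n + 1) → α) :
    pick κ Φ (List.ofFn ξ) =
      ∑ i : Fin (n + 1), κ ^ (i : ℕ) • Φ (ξ i) (List.ofFn fun j => ξ (i.succAbove j)) := by
  induction n generalizing Φ with
  | zero => simp [pick_cons, pick_nil]
  | succ n ih =>
    rw [List.ofFn_succ, pick_cons, ih]
    conv_rhs => rw [Fin.sum_univ_succ]
    rw [Finset.smul_sum]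
    refine congrArg₂ _ (by simp) (Finset.sum_congr rfl fun i _ => ?_)
    rw [smul_smul, Fin.val_succ, pow_succ', List.ofFn_succ]
    simp

/-- `F` changes by the factor `κ` when adjacent elements of its argument are exchanged. -/
def SwapSymm (F : List α → E) : Prop :=
  ∀ (l₁ : List α) (a b : α) (l₂ : List α), F (l₁ ++ a :: b :: l₂) = κ • F (l₁ ++ b :: a :: l₂)

variable {κ}

theorem SwapSymm.cons {F : List α → E} (h : SwapSymm κ F) (v : α) :
    SwapSymm κ fun l => F (v :: l) := fun l₁ a b l₂ => h (v :: l₁) a b l₂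

theorem SwapSymm.smul {F : List α → E} (h : SwapSymm κ F) (c : ℂ) :
    SwapSymm κ fun l => c • F l := fun l₁ a b l₂ => by
  change c • F _ = κ • c • F _
  rw [h, smul_comm]

/-- Exchanging neighbours `a`, `b` also exchanges the two summands that pick one of them; their
positions differ by one, which supplies the same factor `κ`. -/
theorem SwapSymm.pick (hκ : κ * κ = 1) {Φ : α → List α → E} (h : ∀ w, SwapSymm κ (Φ w)) :
    SwapSymm κ (pick κ Φ) := by
  intro l₁ a b l₂
  induction l₁ generalizing Φ with
  | nil =>
    simp only [List.nil_append, pick_cons, smul_add, smul_smul, hκ, one_smul]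
    have h2 : GBF.pick κ (fun w l' => Φ w (a :: b :: l')) l₂ =
        κ • GBF.pick κ (fun w l' => Φ w (b :: a :: l')) l₂ := by
      rw [← pick_smul]
      exact pick_congr κ fun w l' _ => h w [] a b l'
    rw [h2]
    abel
  | cons v l₁ ih =>
    rw [List.cons_append, List.cons_append, pick_cons, pick_cons, h v l₁ a b l₂,
      ih fun w => (h w).cons v, smul_add, smul_comm κ]

theorem SwapSymm.move {F : List α → E} (h : SwapSymm κ F) (l₁ l : List α)
    (a : α) (l₂ : List α) : F (l₁ ++ (l ++ a :: l₂)) = κ ^ l.length • F (l₁ ++ a :: (l ++ l₂)) := by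
  induction l generalizing l₁ with
  | nil => simp
  | cons v l ih =>
    have h1 := ih (l₁ ++ [v])
    simp only [List.append_assoc, List.cons_append, List.nil_append] at h1 ⊢
    rw [h1, h, smul_smul, List.length_cons, pow_succ]

theorem SwapSymm.move_front {F : List α → E} (h : SwapSymm κ F) (l : List α)
    (a : α) (l₂ : List α) : F (l ++ a :: l₂) = κ ^ l.length • F (a :: (l ++ l₂)) := h.move [] l a l₂

/-- Both vectors cross `l`, so those signs cancel and only the vectors between the two matter. -/
theorem SwapSymm.move_pair (hκ : κ * κ = 1) {F : List α → E} (h : SwapSymm κ F) (l l' : List α)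
    (a b : α) (l₂ : List α) :
    F (l ++ a :: (l' ++ b :: l₂)) = κ ^ l'.length • F (a :: b :: (l ++ (l' ++ l₂))) := by
  have h1 := h.move (l ++ [a]) l' b l₂
  simp only [List.append_assoc, List.cons_append, List.nil_append] at h1
  rw [h1, h.move_front, (h.cons a).move_front, smul_smul, smul_smul, mul_assoc, ← mul_pow, hκ,
    one_pow, mul_one]

/-- Of two chosen positions, the later one is shifted by one exactly when it is chosen second;
reversing the order of choice costs one `κ`. -/
theorem pick_pick_comm (Φ : α → α → List α → E) (l : List α) (hκ : κ * κ = 1) :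
    pick κ (fun a => pick κ (Φ a)) l = κ • pick κ (fun a => pick κ fun b => Φ b a) l := by
  induction l generalizing Φ with
  | nil => simp [pick_nil]
  | cons v l ih =>
    have h (Ψ : α → α → List α → E) : pick κ (fun a l' => pick κ (Ψ a) (v :: l')) l =
        pick κ (fun a => Ψ a v) l + κ • pick κ (fun a => pick κ fun b l'' => Ψ a b (v :: l'')) l := by
      rw [← pick_smul, ← pick_add]
      exact pick_congr κ fun w l' _ => pick_cons _ _ _ _
    rw [pick_cons, pick_cons, h, h, ih]
    simp only [smul_add, smul_smul, hκ, one_smul]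
    abel

theorem pick_pick_pick_comm (Φ : α → α → α → List α → E) (l : List α) (hκ : κ * κ = 1) :
    pick κ (fun a => pick κ fun b => pick κ (Φ a b)) l =
      pick κ (fun c => pick κ fun a => pick κ fun b => Φ a b c) l := by
  have h (a : α) := funext fun l' => pick_pick_comm (Φ a) l' hκ
  simp only [h, pick_smul]
  rw [pick_pick_comm _ _ hκ, smul_smul, hκ, one_smul]

end Pick

/-! ### Sums over pairings -/

section Pairings

variable {V : Type*} (κ : ℂ) (B : V → V → ℂ)

open Classical in
/-- `∑ κ^|σ| B(v_σ(1), v_σ(2)) ⋯ B(v_σ(2k-1), v_σ(2k))` over the permutations of a list of `2 k`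
vectors; it is zero on lists of other lengths. -/
def pairSum : ℕ → List V → ℂ
  | 0, l => if l = [] then 1 else 0
  | k + 1, l => pick κ (fun a => pick κ fun b l'' => B a b * pairSum k l'') l

theorem pairSum_zero_cons (v : V) (l : List V) : pairSum κ B 0 (v :: l) = 0 := by simp [pairSum]

theorem pairSum_eq_zero {k : ℕ} {l : List V} (h : l.length ≠ 2 * k) : pairSum κ B k l = 0 := by
  induction k generalizing l with
  | zero =>
    rw [pairSum, if_neg]
    rintro rfl
    simp at h
  | succ k ih =>
    rw [pairSum, ← Submodule.mem_bot ℂ]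
    refine pick_mem κ _ fun a l' h' => pick_mem κ _ fun b l'' h'' => ?_
    rw [ih (by omega), mul_zero]
    exact Submodule.zero_mem _

variable {κ B}

theorem swapSymm_pairSum (hκ : κ * κ = 1) (k : ℕ) : SwapSymm κ (pairSum κ B k) := by
  induction k with
  | zero => intro l₁ a b l₂; simp [pairSum]
  | succ k ih =>
    exact SwapSymm.pick hκ fun a => SwapSymm.pick hκ fun b => ih.smul _

/-- The vector `v` lies in one of `k + 1` ordered pairs, on either side; all `2(k + 1)` placements
contribute equally, by the symmetry of `B` and because whole pairs move past each other without
sign. -/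
theorem pairSum_succ_cons (hκ : κ * κ = 1) (hB : ∀ v w, B v w = κ * B w v) (k : ℕ) (v : V)
    (l : List V) : pairSum κ B (k + 1) (v :: l) =
      (2 * (k + 1) : ℂ) * pick κ (fun w l' => B v w * pairSum κ B k l') l := by
  have h (k : ℕ) (l : List V) : pairSum κ B (k + 1) (v :: l) =
      2 * pick κ (fun w l' => B v w * pairSum κ B k l') l +
        pick κ (fun a => pick κ fun b l'' => B a b * pairSum κ B k (v :: l'')) l := by
    have h1 : pick κ (fun a l' => pick κ (fun b l'' => B a b * pairSum κ B k l'') (v :: l')) l =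
        κ • pick κ (fun w l' => B v w * pairSum κ B k l') l +
          κ • pick κ (fun a => pick κ fun b l'' => B a b * pairSum κ B k (v :: l'')) l := by
      rw [← pick_smul, ← pick_smul, ← pick_add]
      refine pick_congr κ fun w l' _ => ?_
      rw [pick_cons, hB w v, smul_eq_mul, mul_assoc]; rfl
    rw [pairSum, pick_cons, h1, smul_add, smul_smul, smul_smul, hκ, one_smul, one_smul, two_mul,
      add_assoc]
  induction k generalizing l with
  | zero =>
    rw [h]
    have h2 : pick κ (fun a => pick κ fun b l'' => B a b * pairSum κ B 0 (v :: l'')) l = 0 := by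
      simp [pairSum_zero_cons, pick]
    rw [h2]
    simp
  | succ k ih =>
    have h3 : pick κ (fun a => pick κ fun b l'' => B a b * pairSum κ B (k + 1) (v :: l'')) l =
        (2 * (k + 1) : ℂ) * pick κ (fun w l' => B v w * pairSum κ B (k + 1) l') l := by
      have h4 (a b : V) (l'' : List V) : B a b * pairSum κ B (k + 1) (v :: l'') =
          (2 * (k + 1) : ℂ) * pick κ (fun w l' => B v w * (B a b * pairSum κ B k l')) l'' := by
        rw [ih, mul_left_comm, ← pick_mul κ (B a b)]
        simp only [mul_left_comm (B a b)]
      simp only [h4, pick_mul_fun κ (2 * (k + 1) : ℂ)]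
      congr 1
      -- The partner of `v` is now chosen before the pair `a`, `b`, so that the choices of `a` and
      -- `b` reassemble into `pairSum` at `k + 1`.
      rw [pick_pick_pick_comm _ _ hκ]
      simp only [pick_mul_fun, pairSum]
    rw [h, h3]
    push_cast
    ring

/-- The sum over all pairings of a list of vectors, normalized so that the amplitude of a state
is the value on the list of its vectors. -/
def wick (κ : ℂ) (B : V → V → ℂ) (l : List V) : ℂ :=
  ((l.length / 2).factorial : ℂ)⁻¹ * pairSum κ B (l.length / 2) l

theorem wick_nil : wick κ B [] = 1 := by simp [wick, pairSum]

/-- The division by `k!` turns the factor `2(k + 1)` of `pairSum_succ_cons` into a plain `2`; if the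
total length is odd, both sides vanish. -/
theorem wick_cons (hκ : κ * κ = 1) (hB : ∀ v w, B v w = κ * B w v) (v : V) (l : List V) :
    wick κ B (v :: l) = 2 * pick κ (fun w l' => B v w * wick κ B l') l := by
  obtain ⟨k, hk | hk⟩ := Nat.even_or_odd' l.length
  · have h1 : pick κ (fun w l' => B v w * wick κ B l') l = 0 := by
      rw [← Submodule.mem_bot ℂ]
      refine pick_mem κ _ fun w l' h => ?_
      rw [wick, pairSum_eq_zero _ _ (by omega)]
      simp
    rw [h1, wick, pairSum_eq_zero _ _ (by rw [List.length_cons]; omega)]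
    simp
  · have h1 : pick κ (fun w l' => B v w * wick κ B l') l =
        pick κ (fun w l' => (k.factorial : ℂ)⁻¹ * (B v w * pairSum κ B k l')) l := by
      refine pick_congr κ fun w l' h => ?_
      rw [wick, show l'.length / 2 = k by omega, mul_left_comm]
    rw [h1, wick, show (v :: l).length / 2 = k + 1 by rw [List.length_cons]; omega,
      pairSum_succ_cons hκ hB, pick_mul, Nat.factorial_succ]
    have h2 : (k : ℂ) + 1 ≠ 0 := by exact_mod_cast k.succ_ne_zero
    push_cast
    field_simp

theorem swapSymm_wick (hκ : κ * κ = 1) : SwapSymm κ (wick κ B) := by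
  intro l₁ a b l₂
  have h : (l₁ ++ a :: b :: l₂).length = (l₁ ++ b :: a :: l₂).length := by simp
  rw [wick, wick, h, swapSymm_pairSum hκ, smul_eq_mul, smul_eq_mul, mul_left_comm]

end Pairings

/-! ### Amplitudes as sums over pairings -/

section Perm

variable {n : ℕ}

/-- The permutation of `Fin (n + 1)` that sends `p` to `j` and is `σ` between the complements. -/
def extendPerm (p j : Fin (n + 1)) (σ : Equiv.Perm (Fin n)) : Equiv.Perm (Fin (n + 1)) :=
  j.cycleRange⁻¹ * Equiv.Perm.decomposeFin.symm (0, σ) * p.cycleRange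

theorem extendPerm_self (p j : Fin (n + 1)) (σ : Equiv.Perm (Fin n)) :
    extendPerm p j σ p = j := by
  simp [extendPerm, Equiv.Perm.inv_def]

theorem extendPerm_succAbove (p j : Fin (n + 1)) (σ : Equiv.Perm (Fin n)) (i : Fin n) :
    extendPerm p j σ (p.succAbove i) = j.succAbove (σ i) := by
  simp [extendPerm, Equiv.Perm.inv_def]

theorem extendPerm_bijective (p : Fin (n + 1)) :
    Function.Bijective fun x : Fin (n + 1) × Equiv.Perm (Fin n) => extendPerm p x.1 x.2 := by
  rw [Fintype.bijective_iff_injective_and_card]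
  constructor
  · rintro ⟨j, σ⟩ ⟨j', σ'⟩ h
    obtain rfl : j = j' := by
      rw [← extendPerm_self p j σ, ← extendPerm_self p j' σ']
      exact congrArg (fun τ : Equiv.Perm _ => τ p) h
    refine Prod.ext rfl (Equiv.ext fun i => j.succAbove_right_injective ?_)
    change j.succAbove (σ i) = j.succAbove (σ' i)
    rw [← extendPerm_succAbove p, ← extendPerm_succAbove p]
    exact congrArg (fun τ : Equiv.Perm _ => τ (p.succAbove i)) h
  · simp [Fintype.card_perm, Nat.factorial_succ]

theorem permSign_cycleRange (s : Statistics) (j : Fin n) :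
    s.permSign j.cycleRange = s.kappa ^ (j : ℕ) := by
  cases s <;> simp [Statistics.permSign, Statistics.kappa]

/-- The cycles that bring `p` and `j` to position `0` have signs `κ^p` and `κ^j`. -/
theorem permSign_extendPerm (s : Statistics) (p j : Fin (n + 1)) (σ : Equiv.Perm (Fin n)) :
    s.permSign (extendPerm p j σ) = s.kappa ^ (p : ℕ) * s.kappa ^ (j : ℕ) * s.permSign σ := by
  have h : s.permSign (Equiv.Perm.decomposeFin.symm (0, σ)) = s.permSign σ := by
    cases s <;> simp [Statistics.permSign]
  rw [extendPerm, s.permSign_mul, s.permSign_mul, s.permSign_inv, permSign_cycleRange,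
    permSign_cycleRange, h]
  ring

theorem sum_perm_succ {M : Type*} [AddCommMonoid M] (p : Fin (n + 1))
    (f : Equiv.Perm (Fin (n + 1)) → M) :
    ∑ σ, f σ = ∑ j, ∑ σ : Equiv.Perm (Fin n), f (extendPerm p j σ) := by
  rw [← Fintype.sum_prod_type']
  exact (Fintype.sum_bijective _ (extendPerm_bijective p) _ _ fun _ => rfl).symm

end Perm

section Amplitude

variable {V : Type*}

/-- The amplitude pairs positions from the outside inwards, `pairSum` pairs consecutive ones.
Peeling off the images of the first and last positions matches the two; an even number of vectors
lies between them, so no sign appears. -/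
theorem sum_perm_pairs_eq_pairSum (s : Statistics) (B : V → V → ℂ) (k : ℕ) {N : ℕ}
    (hN : N = 2 * k) (ξ : Fin N → V) : ∑ σ : Equiv.Perm (Fin N), s.permSign σ *
      ∏ j : Fin k, B (ξ (σ (Fin.castLE (by omega) j))) (ξ (σ (Fin.castLE (by omega) j).rev)) =
        pairSum s.kappa B k (List.ofFn ξ) := by
  induction k generalizing N with
  | zero =>
    subst hN
    change ∑ σ : Equiv.Perm (Fin 0), _ = _
    simp [pairSum, s.permSign_one]
  | succ k ih =>
    obtain rfl : N = 2 * k + 1 + 1 := by omega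
    rw [sum_perm_succ 0]
    simp only [sum_perm_succ (Fin.last (2 * k)), permSign_extendPerm]
    rw [pairSum, pick_ofFn]
    refine Finset.sum_congr rfl fun i _ => ?_
    rw [pick_ofFn, Finset.smul_sum]
    refine Finset.sum_congr rfl fun j _ => ?_
    rw [← ih rfl]
    simp only [smul_eq_mul, Finset.mul_sum]
    refine Finset.sum_congr rfl fun σ _ => ?_
    have h1 (h : k + 1 ≤ 2 * k + 1 + 1) : Fin.castLE h 0 = 0 := rfl
    have h2 : Fin.rev (0 : Fin (2 * k + 1 + 1)) = Fin.succAbove 0 (Fin.last (2 * k)) := by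
      ext; simp
    have h3 (h : k + 1 ≤ 2 * k + 1 + 1) (x : Fin k) : Fin.castLE h x.succ =
        Fin.succAbove 0 ((Fin.last (2 * k)).succAbove (Fin.castLE (by omega) x)) := by
      ext; simp
    have h4 (x : Fin (2 * k)) : Fin.rev (Fin.succAbove 0 ((Fin.last (2 * k)).succAbove x)) =
        Fin.succAbove 0 ((Fin.last (2 * k)).succAbove x.rev) := by
      ext
      simp [Fin.val_rev]
      omega
    rw [Fin.prod_univ_succ]
    simp only [h1, h2, h3, h4, extendPerm_self, extendPerm_succAbove]
    -- After the removal of position `0`, the last position has the even index `2k`, so that its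
    -- sign is `1`.
    rw [Fin.val_last, pow_mul, sq, s.kappa_mul_self, one_pow]
    simp only [Fin.val_zero, pow_zero]
    ring

variable {L : Type*} [NormedAddCommGroup L] [InnerProductSpace ℂ L] [CompleteSpace L]
  [KreinSpace L] {s : Statistics} {W : Submodule ℝ L} (hW : IsAdmissible s W)

theorem amplitudeValue_eq_wick {N : ℕ} (ξ : Fin N → L) :
    amplitudeValue hW ξ = wick s.kappa (pairing hW) (List.ofFn ξ) := by
  unfold amplitudeValue wick
  rw [List.length_ofFn]
  split_ifs with h
  · congr 1
    exact sum_perm_pairs_eq_pairSum s (pairing hW) (N / 2) (Nat.two_mul_div_two_of_even h).symm ξ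
  · rw [pairSum_eq_zero, mul_zero]
    rw [List.length_ofFn]
    exact fun h' => h (h' ▸ even_two_mul _)

end Amplitude

/-! ### Sums over repeated insertions of pairs of vectors -/

section Insertion

variable {V ι : Type*} [Fintype ι]

/-- The sum of `c a₁ ⋯ c aₘ F(x aₘ, y aₘ, …, x a₁, y a₁, l)` over all `a₁, …, aₘ`. -/
def insertSum (F : List V → ℂ) (c : ι → ℂ) (x y : ι → V) : ℕ → List V → ℂ
  | 0, l => F l
  | m + 1, l => ∑ a, c a * insertSum F c x y m (x a :: y a :: l)

variable {κ : ℂ} {F : List V → ℂ} {c : ι → ℂ} {x y : ι → V}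

theorem SwapSymm.insertSum (hF : SwapSymm κ F) (m : ℕ) : SwapSymm κ (insertSum F c x y m) := by
  induction m with
  | zero => exact hF
  | succ m ih =>
    intro l₁ a b l₂
    simp only [GBF.insertSum, smul_eq_mul, Finset.mul_sum]
    refine Finset.sum_congr rfl fun i _ => ?_
    rw [mul_left_comm, ← smul_eq_mul κ]
    exact congrArg (c i * ·) (ih (x i :: y i :: l₁) a b l₂)

/-- Once the two copies are adjacent, their exchange shows that the value is its own negative. -/
theorem SwapSymm.eq_zero_of_duplicate (hF : SwapSymm κ F) (hκ : κ = -1) (a : V) (l₁ l₂ : List V) :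
    F (a :: (l₁ ++ a :: l₂)) = 0 := by
  have h1 := hF.move [a] l₁ a l₂
  have h2 := hF [] a a (l₁ ++ l₂)
  simp only [List.cons_append, List.nil_append, hκ, smul_eq_mul] at h1 h2
  rw [h1, show F (a :: a :: (l₁ ++ l₂)) = 0 by linear_combination h2 / 2, mul_zero]

/-- Here `t` records indices whose `x a` already occurs in the list. Each further insertion either
repeats one of them or enlarges `t`, which cannot outgrow the index type. -/
theorem insertSum_eq_zero_of_mem (hF : SwapSymm κ F) (hκ : κ = -1) (t : Finset ι) (m : ℕ)
    (h : Fintype.card ι < m + t.card) (l : List V) (hl : ∀ a ∈ t, x a ∈ l) :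
    insertSum F c x y m l = 0 := by
  classical
  induction m generalizing t l with
  | zero => exact absurd t.card_le_univ (by omega)
  | succ m ih =>
    refine Finset.sum_eq_zero fun a _ => ?_
    by_cases ha : a ∈ t
    · obtain ⟨l₁, l₂, rfl⟩ := List.append_of_mem (hl a ha)
      rw [show x a :: y a :: (l₁ ++ x a :: l₂) = x a :: ((y a :: l₁) ++ x a :: l₂) from rfl,
        (hF.insertSum m).eq_zero_of_duplicate hκ, mul_zero]
    · rw [ih (insert a t) (by rw [Finset.card_insert_of_notMem ha]; omega), mul_zero]
      intro b hb
      obtain rfl | hb := Finset.mem_insert.1 hb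
      · simp
      · simp [hl b hb]

theorem insertSum_eq_zero (hF : SwapSymm κ F) (hκ : κ = -1) {m : ℕ} (h : Fintype.card ι < m)
    (l : List V) : insertSum F c x y m l = 0 :=
  insertSum_eq_zero_of_mem hF hκ ∅ m (by simpa using h) l (by simp)

/-- The reversal of the `y`'s, which comes from `ι`, nests each pair around the later ones. Between
`x a` and `y a` stand evenly many vectors, so all pairs reach the front without sign. -/
theorem sum_prod_mul_insert (hκ : κ * κ = 1) (hF : SwapSymm κ F) {d : ℕ} {c : Fin d → ℂ}
    {x y : Fin d → V} (m : ℕ) (l : List V) :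
    ∑ a : Fin m → Fin d, (∏ i, c (a i)) * F (l ++ (List.ofFn fun i => x (a i)) ++
      List.ofFn fun i : Fin m => y (a i.rev)) = insertSum F c x y m l := by
  induction m generalizing l with
  | zero => simp [insertSum]
  | succ m ih =>
    rw [← (Fin.consEquiv fun _ => Fin d).sum_comp, Fintype.sum_prod_type, insertSum]
    refine Finset.sum_congr rfl fun a₀ _ => ?_
    rw [← ih, Finset.mul_sum]
    refine Finset.sum_congr rfl fun a _ => ?_
    have h1 : (List.ofFn fun i : Fin (m + 1) => y ((Fin.cons a₀ a : Fin (m + 1) → Fin d) i.rev)) =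
        (List.ofFn fun i : Fin m => y (a i.rev)) ++ [y a₀] := by
      rw [List.ofFn_succ']
      simp [List.concat_eq_append, Fin.rev_castSucc]
    have h2 := hF.move_pair hκ l ((List.ofFn fun i => x (a i)) ++
      List.ofFn fun i : Fin m => y (a i.rev)) (x a₀) (y a₀) []
    have h3 : κ ^ ((List.ofFn fun i => x (a i)) ++
      List.ofFn fun i : Fin m => y (a i.rev)).length = 1 := by
      rw [List.length_append, List.length_ofFn, List.length_ofFn, ← two_mul, pow_mul, sq, hκ,
        one_pow]
    rw [h3, one_smul] at h2
    change (∏ i, c ((Fin.cons a₀ a : Fin (m + 1) → Fin d) i)) * F (l ++ (List.ofFn fun i =>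
      x ((Fin.cons a₀ a : Fin (m + 1) → Fin d) i)) ++ List.ofFn fun i : Fin (m + 1) =>
        y ((Fin.cons a₀ a : Fin (m + 1) → Fin d) i.rev)) = _
    rw [h1, List.ofFn_succ, Fin.prod_univ_succ]
    simp only [Fin.cons_zero, Fin.cons_succ, List.append_assoc, List.cons_append, List.append_nil] at h2 ⊢
    rw [h2, mul_assoc]

end Insertion

/-! ### Contraction identities for sums with inserted pairs. -/

section Series

variable {V ι : Type*} [AddCommGroup V] [Module ℂ V] [Fintype ι] (κ : ℂ)
  (B : V →ₗ⋆[ℂ] V →ₗ⋆[ℂ] ℂ) (c : ι → ℂ) (x y : ι → V)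

/-- The coefficients with which a contraction of `v` with an inserted vector `x a` or `y a` leaves
the partner `y a` or `x a` of that vector. -/
def insertCoeff (v : V) : ι ⊕ ι → ℂ :=
  Sum.elim (fun a => κ * c a * B v (y a)) fun a => c a * B v (x a)

/-- The terms `1/(2^m m!) ∑ c a₁ ⋯ c aₘ F(x aₘ, y aₘ, …, x a₁, y a₁, l)`, where `F` is the sum over
pairings. -/
def insertTerm (m : ℕ) (l : List V) : ℂ :=
  (2 ^ m * m.factorial : ℂ)⁻¹ * insertSum (wick κ fun v w => B v w) c x y m l

variable {κ B c x y}

/-- The first vector is contracted either with a vector of `l` or with an inserted one. In the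
second case the partner survives, and the `m + 1` insertions contribute alike. -/
theorem insertSum_cons (hκ : κ * κ = 1) (hB : ∀ v w, B v w = κ * B w v) (m : ℕ) (v : V)
    (l : List V) : insertSum (wick κ fun v w => B v w) c x y (m + 1) (v :: l) =
      2 * pick κ (fun w l' => B v w * insertSum (wick κ fun v w => B v w) c x y (m + 1) l') l +
        2 * (m + 1) * ∑ i, insertCoeff κ B c x y v i *
          insertSum (wick κ fun v w => B v w) c x y m (Sum.elim x y i :: l) := by
  set F := insertSum (wick κ fun v w => B v w) c x y with hFdef
  have hF (m : ℕ) : SwapSymm κ (F m) := (swapSymm_wick hκ).insertSum m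
  have comm (m : ℕ) (v : V) (a : ι) (l : List V) : F m (x a :: y a :: v :: l) =
      F m (v :: x a :: y a :: l) := by
    have h1 := (hF m).move [] [x a, y a] v l
    simpa [sq, hκ] using h1
  -- Contraction with `x a` at position `0` leaves `y a`, contraction with `y a` at position `1`
  -- costs `κ` and leaves `x a`, and the vectors of `l` pick up `κ² = 1`.
  have step (m : ℕ) (a : ι) (l : List V) (R : ℂ) (h : F m (v :: x a :: y a :: l) =
      2 * pick κ (fun w l' => B v w * F m l') (x a :: y a :: l) + R) :
      F m (x a :: y a :: v :: l) = 2 * B v (x a) * F m (y a :: l) + 2 * κ * B v (y a) * F m (x a :: l)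
        + 2 * pick κ (fun w l' => B v w * F m (x a :: y a :: l')) l + R := by
    rw [comm, h, pick_cons, pick_cons]
    simp only [smul_eq_mul]
    linear_combination 2 * pick κ (fun w l' => B v w * F m (x a :: y a :: l')) l * hκ
  -- `R a` collects the contractions of `v` with the other `m` insertions: zero at the start, and
  -- supplied by the induction hypothesis afterwards.
  have total (m : ℕ) (l : List V) (R : ι → ℂ) (h : ∀ a, F m (v :: x a :: y a :: l) =
      2 * pick κ (fun w l' => B v w * F m l') (x a :: y a :: l) + R a) :
      F (m + 1) (v :: l) = 2 * pick κ (fun w l' => B v w * F (m + 1) l') l +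
        2 * ∑ i, insertCoeff κ B c x y v i * F m (Sum.elim x y i :: l) + ∑ a, c a * R a := by
    change ∑ a, c a * F m (x a :: y a :: v :: l) = _
    have h2 : pick κ (fun w l' => B v w * F (m + 1) l') l =
        ∑ a, c a * pick κ (fun w l' => B v w * F m (x a :: y a :: l')) l := by
      simp only [← pick_mul, ← pick_sum]
      refine pick_congr κ fun w l' _ => ?_
      change B v w * ∑ a, c a * F m (x a :: y a :: l') = _
      rw [Finset.mul_sum]
      exact Finset.sum_congr rfl fun a _ => by ring
    rw [h2, Fintype.sum_sum_type]
    simp only [insertCoeff, Sum.elim_inl, Sum.elim_inr, Finset.mul_sum, ← Finset.sum_add_distrib]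
    refine Finset.sum_congr rfl fun a _ => ?_
    rw [step m a l _ (h a)]
    ring
  induction m generalizing l with
  | zero =>
    rw [total 0 l (fun _ => 0) fun a => by rw [add_zero]; exact wick_cons hκ hB _ _]
    simp
  | succ m ih =>
    rw [total (m + 1) l _ fun a => ih _]
    have h3 (i : ι ⊕ ι) : F (m + 1) (Sum.elim x y i :: l) =
        ∑ a, c a * F m (Sum.elim x y i :: x a :: y a :: l) := by
      simp only [← comm]
      rfl
    have h4 : ∑ a, c a * (2 * (m + 1) * ∑ i, insertCoeff κ B c x y v i *
        F m (Sum.elim x y i :: x a :: y a :: l)) = 2 * (m + 1) *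
          ∑ i, insertCoeff κ B c x y v i * F (m + 1) (Sum.elim x y i :: l) := by
      simp only [h3, Finset.mul_sum]
      rw [Finset.sum_comm]
      exact Finset.sum_congr rfl fun i _ => Finset.sum_congr rfl fun a _ => by ring
    rw [h4]
    push_cast
    ring

theorem insertTerm_zero_nil : insertTerm κ B c x y 0 [] = 1 := by
  simp [insertTerm, insertSum, wick_nil]

/-- This is the differentiation of the generating series: the factor `m + 1` cancels into `m!`, and
one inserted pair becomes explicit. -/
theorem insertTerm_succ (m : ℕ) (l : List V) : (m + 1) * insertTerm κ B c x y (m + 1) l =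
    2⁻¹ * ∑ a, c a * insertTerm κ B c x y m (x a :: y a :: l) := by
  have h2 : (m : ℂ) + 1 ≠ 0 := by exact_mod_cast m.succ_ne_zero
  simp only [insertTerm, mul_left_comm (c _), ← Finset.mul_sum, insertSum, Nat.factorial_succ]
  push_cast
  field_simp
  ring

theorem insertTerm_succ_cons (hκ : κ * κ = 1) (hB : ∀ v w, B v w = κ * B w v) (m : ℕ) (v : V)
    (l : List V) : insertTerm κ B c x y (m + 1) (v :: l) =
      2 * pick κ (fun w l' => B v w * insertTerm κ B c x y (m + 1) l') l +
        ∑ i, insertCoeff κ B c x y v i * insertTerm κ B c x y m (Sum.elim x y i :: l) := by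
  have h2 : (m : ℂ) + 1 ≠ 0 := by exact_mod_cast m.succ_ne_zero
  simp only [insertTerm, mul_left_comm _ (_⁻¹), pick_mul, ← Finset.mul_sum]
  rw [insertSum_cons hκ hB, Nat.factorial_succ]
  push_cast
  field_simp
  ring

theorem insertTerm_zero_cons (hκ : κ * κ = 1) (hB : ∀ v w, B v w = κ * B w v) (v : V)
    (l : List V) : insertTerm κ B c x y 0 (v :: l) =
      2 * pick κ (fun w l' => B v w * insertTerm κ B c x y 0 l') l := by
  simp only [insertTerm, insertSum, mul_left_comm _ (_⁻¹), pick_mul]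
  rw [wick_cons hκ hB]

end Series

/-! ### Absolute convergence -/

open scoped Matrix

section Jacobi

theorem _root_.Derivation.map_prod_eq_sum {R A ι : Type*} [CommSemiring R] [CommSemiring A]
    [Algebra R A] [DecidableEq ι] (D : Derivation R A A) (t : Finset ι) (f : ι → A) :
    D (∏ i ∈ t, f i) = ∑ i ∈ t, (∏ j ∈ t.erase i, f j) * D (f i) := by
  induction t using Finset.induction_on with
  | empty => simp
  | insert a t ha ih =>
    rw [Finset.prod_insert ha, D.leibniz, ih, Finset.sum_insert ha, Finset.erase_insert ha,
      smul_eq_mul, smul_eq_mul, add_comm, Finset.mul_sum]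
    congr 1
    refine Finset.sum_congr rfl fun i hi => ?_
    rw [Finset.erase_insert_of_ne (by rintro rfl; exact ha hi),
      Finset.prod_insert (fun h => ha (Finset.mem_of_mem_erase h)), mul_assoc]

/-- Jacobi's formula for the derivative of a determinant. -/
theorem _root_.Derivation.map_det {R A n : Type*} [CommRing R] [CommRing A] [Algebra R A]
    [Fintype n] [DecidableEq n] (D : Derivation R A A) (M : Matrix n n A) :
    D M.det = (M.adjugate * M.map D).trace := by
  have h (i : n) : (M.adjugate * M.map D) i i =
      ∑ σ : Equiv.Perm n, Equiv.Perm.sign σ •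
        ((∏ j ∈ Finset.univ.erase i, M (σ j) j) * D (M (σ i) i)) := by
    -- By Cramer's rule, the diagonal entry is the determinant of `M` with column `i` replaced by
    -- its derivative.
    change (M.adjugate *ᵥ fun k => D (M k i)) i = _
    rw [← Matrix.cramer_eq_adjugate_mulVec, Matrix.cramer_apply, Matrix.det_apply]
    refine Finset.sum_congr rfl fun σ _ => ?_
    rw [← Finset.prod_erase_mul _ _ (Finset.mem_univ i), Matrix.updateCol_self]
    congr 2
    exact Finset.prod_congr rfl fun j hj => by rw [Matrix.updateCol_ne (Finset.ne_of_mem_erase hj)]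
  simp only [Matrix.trace, Matrix.diag_apply, h]
  rw [Finset.sum_comm, Matrix.det_apply, map_sum]
  refine Finset.sum_congr rfl fun σ _ => ?_
  rw [← Finset.smul_sum, ← D.map_prod_eq_sum, Units.smul_def, Units.smul_def, map_zsmul]

end Jacobi

/-! ### Generating series and the algebra of series absolutely convergent at `1`. -/

section AbsSummable

open PowerSeries

/-- The power series that converge absolutely at `1`. -/
def absSummable : Subalgebra ℂ ℂ⟦X⟧ where
  carrier := {f | Summable fun n => ‖coeff n f‖}
  mul_mem' {f g} hf hg := by
    have h := summable_norm_sum_mul_antidiagonal_of_summable_norm hf hg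
    simpa only [Set.mem_ofPred_eq, coeff_mul] using h
  add_mem' {f g} hf hg := by
    refine Summable.of_nonneg_of_le (fun _ => norm_nonneg _) (fun n => ?_) (hf.add hg)
    rw [map_add]
    exact norm_add_le _ _
  algebraMap_mem' c := by
    refine summable_of_ne_finset_zero (s := {0}) fun n hn => ?_
    rw [PowerSeries.algebraMap_apply, coeff_C, if_neg (by simpa using hn), norm_zero]

theorem X_mem_absSummable : (X : ℂ⟦X⟧) ∈ absSummable := by
  refine summable_of_ne_finset_zero (s := {1}) fun n hn => ?_
  rw [coeff_X, if_neg (by simpa using hn), norm_zero]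

/-- The adjugate can be formed inside the subalgebra, since ring homomorphisms commute with it. -/
theorem adjugate_mem {R A n : Type*} [CommRing R] [CommRing A] [Algebra R A] [Fintype n]
    [DecidableEq n] (S : Subalgebra R A) {M : Matrix n n A} (h : ∀ i j, M i j ∈ S) (i j : n) :
    M.adjugate i j ∈ S := by
  have h1 := S.val.map_adjugate (Matrix.of fun i j => (⟨M i j, h i j⟩ : S))
  have h2 : S.val.mapMatrix (Matrix.of fun i j => (⟨M i j, h i j⟩ : S)) = M := rfl
  rw [h2] at h1
  rw [← h1]
  exact Subtype.property _

variable {V ι : Type*} [AddCommGroup V] [Module ℂ V] [Fintype ι] (κ : ℂ)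
  (B : V →ₗ⋆[ℂ] V →ₗ⋆[ℂ] ℂ) (c : ι → ℂ) (x y : ι → V)

/-- The power series with the coefficients `insertTerm`. -/
def insertSeries (l : List V) : ℂ⟦X⟧ := mk fun m => insertTerm κ B c x y m l

variable {κ B c x y}

theorem coeff_insertSeries (m : ℕ) (l : List V) :
    coeff m (insertSeries κ B c x y l) = insertTerm κ B c x y m l := coeff_mk _ _

theorem insertSeries_cons (hκ : κ * κ = 1) (hB : ∀ v w, B v w = κ * B w v) (v : V) (l : List V) :
    insertSeries κ B c x y (v :: l) =
      (2 : ℂ) • pick κ (fun w l' => B v w • insertSeries κ B c x y l') l +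
        X * ∑ i, insertCoeff κ B c x y v i • insertSeries κ B c x y (Sum.elim x y i :: l) := by
  ext m
  rw [map_add, map_smul, map_pick]
  cases m with
  | zero =>
    simp only [coeff_insertSeries, coeff_zero_X_mul, map_smul, smul_eq_mul]
    rw [insertTerm_zero_cons hκ hB, add_zero]
  | succ m =>
    simp only [coeff_insertSeries, coeff_succ_X_mul, map_smul, smul_eq_mul, map_sum]
    rw [insertTerm_succ_cons hκ hB]

theorem derivative_insertSeries (l : List V) : d⁄dX ℂ (insertSeries κ B c x y l) =
    (2⁻¹ : ℂ) • ∑ a, c a • insertSeries κ B c x y (x a :: y a :: l) := by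
  ext m
  simp only [coeff_derivative, coeff_insertSeries, map_smul, map_sum, smul_eq_mul]
  rw [← insertTerm_succ, mul_comm]

theorem insertSeries_mem_absSummable_of_neg_one (l : List V) :
    insertSeries (-1) B c x y l ∈ absSummable := by
  refine summable_of_ne_finset_zero (s := Finset.range (Fintype.card ι + 1)) fun m hm => ?_
  rw [coeff_insertSeries, insertTerm, insertSum_eq_zero (swapSymm_wick (by norm_num)) rfl, mul_zero,
    norm_zero]
  simpa using hm

variable (κ B c x y) in
/-- The matrix of contractions between inserted vectors. -/
def insertKernel : Matrix (ι ⊕ ι) (ι ⊕ ι) ℂ :=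
  Matrix.of fun i => insertCoeff κ B c x y (Sum.elim x y i)

variable [DecidableEq ι]

variable (κ B c x y) in
/-- The matrix `1 - X N`, where `N` is the matrix of contractions between inserted vectors. -/
def insertMatrix : Matrix (ι ⊕ ι) (ι ⊕ ι) ℂ⟦X⟧ :=
  1 - (X : ℂ⟦X⟧) • (insertKernel κ B c x y).map C

/-- This is `insertSeries_cons` for an inserted first vector, with the terms that keep the length of
the list moved to the left. It is a linear system whose right side has only shorter lists. -/
theorem insertMatrix_mulVec (hκ : κ * κ = 1) (hB : ∀ v w, B v w = κ * B w v) (l : List V) :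
    insertMatrix κ B c x y *ᵥ (fun i => insertSeries κ B c x y (Sum.elim x y i :: l)) =
      fun i => (2 : ℂ) • pick κ (fun w l' => B (Sum.elim x y i) w • insertSeries κ B c x y l') l := by
  funext i
  have h := insertSeries_cons (c := c) (x := x) (y := y) hκ hB (Sum.elim x y i) l
  rw [insertMatrix, Matrix.sub_mulVec, Matrix.one_mulVec, Matrix.smul_mulVec, Pi.sub_apply, h,
    add_sub_assoc, add_eq_left, sub_eq_zero]
  simp [Matrix.mulVec, dotProduct, insertKernel, smul_eq_C_mul]

/-- The vacuum series `P []` behaves like a Gaussian integral, `det(1 - XN)^(-1/2)`. The proof is by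
an ODE: `P []'` is a trace of two-point functions, these solve a linear system with matrix `1 - XN`,
and Jacobi's formula identifies the result with the logarithmic derivative of the determinant. -/
theorem det_mul_insertSeries_sq (hB : ∀ v w, B v w = B w v) :
    (insertMatrix 1 B c x y).det * insertSeries 1 B c x y [] ^ 2 = 1 := by
  set A := insertMatrix 1 B c x y with hA
  set P := insertSeries 1 B c x y with hP
  let e : ι ⊕ ι → ℂ := Sum.elim c c
  -- The weighted two-point functions; the swap of the second index makes each diagonal entry pair
  -- an inserted vector with its own partner.
  let Q : Matrix (ι ⊕ ι) (ι ⊕ ι) ℂ⟦X⟧ := Matrix.of fun i j =>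
    e j • P [Sum.elim x y i, Sum.elim x y j.swap]
  have hQ : A * Q = (2 * P []) • (insertKernel 1 B c x y).map C := by
    ext1 i j
    have h1 := congrFun (insertMatrix_mulVec (c := c) (x := x) (y := y) (one_mul 1)
      (fun v w => by rw [one_mul, hB]) [Sum.elim x y j.swap]) i
    have h2 : (A * Q) i j = e j • (A *ᵥ fun i => P [Sum.elim x y i, Sum.elim x y j.swap]) i := by
      rw [← Pi.smul_apply, ← Matrix.mulVec_smul]
      rfl
    rw [h2, h1, pick_cons, pick_nil]
    have h3 : e j * B (Sum.elim x y i) (Sum.elim x y j.swap) = insertKernel 1 B c x y i j := by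
      cases j <;> simp [e, insertKernel, insertCoeff]
    rw [Matrix.smul_apply, Matrix.map_apply, ← h3]
    simp only [smul_zero, add_zero, smul_eq_C_mul, map_mul, smul_eq_mul]
    rw [show (C 2 : ℂ⟦X⟧) = 2 from map_ofNat C 2]
    ring
  -- Each pair occurs twice on the diagonal, as `(x a, y a)` and `(y a, x a)`, and the derivative
  -- carries a factor `1/2`; hence the `4`.
  have htr : Q.trace = 4 * d⁄dX ℂ (P []) := by
    have hs (v w : V) : P [v, w] = P [w, v] := by
      ext m
      have := ((swapSymm_wick (B := fun v w => B v w) (one_mul 1)).insertSum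
        (c := c) (x := x) (y := y) m) [] v w []
      rw [one_smul] at this
      simp only [hP, coeff_insertSeries, insertTerm]
      rw [List.nil_append, List.nil_append] at this
      rw [this]
    rw [derivative_insertSeries, Matrix.trace, Fintype.sum_sum_type]
    simp only [Q, e, Matrix.diag_apply, Matrix.of_apply, Sum.elim_inl, Sum.elim_inr, Sum.swap_inl,
      Sum.swap_inr]
    simp only [fun a => hs (y a) (x a), ← two_mul, smul_eq_C_mul]
    rw [← mul_assoc, show (4 : ℂ⟦X⟧) * C 2⁻¹ = 2 by
      rw [show (4 : ℂ⟦X⟧) = C 4 from (map_ofNat C 4).symm, ← map_mul,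
        show (2 : ℂ⟦X⟧) = C 2 from (map_ofNat C 2).symm]
      norm_num]
  have hD : d⁄dX ℂ A.det = -(A.adjugate * (insertKernel 1 B c x y).map C).trace := by
    rw [Derivation.map_det, ← Matrix.trace_neg, ← Matrix.mul_neg]
    congr 2
    ext1 i j
    rw [Matrix.map_apply, hA, insertMatrix, Matrix.sub_apply, map_sub, Matrix.smul_apply,
      Matrix.map_apply, smul_eq_mul, Derivation.leibniz, derivative_C, derivative_X]
    simp [Matrix.one_apply, apply_ite]
  have hODE : 2 * A.det * d⁄dX ℂ (P []) + P [] * d⁄dX ℂ A.det = 0 := by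
    have h1 : A.det • Q = (2 * P []) • (A.adjugate * (insertKernel 1 B c x y).map C) := by
      rw [← Matrix.mul_smul, ← hQ, ← Matrix.mul_assoc, Matrix.adjugate_mul, Matrix.smul_mul,
        Matrix.one_mul]
    have h2 := congrArg Matrix.trace h1
    rw [Matrix.trace_smul, Matrix.trace_smul, htr, smul_eq_mul, smul_eq_mul] at h2
    rw [hD]
    have h4 : (2 : ℂ⟦X⟧) ≠ 0 := by
      rw [show (2 : ℂ⟦X⟧) = C 2 from (map_ofNat C 2).symm]
      exact (map_ne_zero_iff C C_injective).2 two_ne_zero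
    refine mul_left_cancel₀ h4 ?_
    linear_combination h2
  -- A power series over `ℂ` is determined by its derivative and constant coefficient; here these
  -- are `P [] * hODE = 0` and `1`.
  refine derivative.ext ?_ ?_
  · rw [Derivation.leibniz, derivative_pow, derivative_one, smul_eq_mul, smul_eq_mul]
    push_cast
    linear_combination P [] * hODE
  · have h1 : constantCoeff (P []) = 1 := by
      rw [← coeff_zero_eq_constantCoeff_apply, hP, coeff_insertSeries, insertTerm_zero_nil]
    have h2 : constantCoeff A.det = 1 := by
      rw [RingHom.map_det, hA, insertMatrix, map_sub, map_one]
      have h3 : (constantCoeff (R := ℂ)).mapMatrix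
          ((X : ℂ⟦X⟧) • (insertKernel 1 B c x y).map C) = 0 := by
        ext i j
        simp
      rw [h3, sub_zero, Matrix.det_one]
    simp [h1, h2]

/-- By induction on the length of `l`: the series with an inserted first vector solve the system of
`insertMatrix_mulVec`, and `P_[]²` times the adjugate inverts its matrix within `absSummable`. -/
theorem insertSeries_mem_absSummable_of_one (hB : ∀ v w, B v w = B w v)
    (h : insertSeries 1 B c x y [] ∈ absSummable) (l : List V) :
    insertSeries 1 B c x y l ∈ absSummable := by
  have hB' (v w : V) : B v w = 1 * B w v := by rw [one_mul, hB]
  suffices ∀ n (l : List V), l.length = n → insertSeries 1 B c x y l ∈ absSummable from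
    this _ l rfl
  intro n
  induction n using Nat.strong_induction_on with
  | _ n ih =>
  intro l hl
  cases l with
  | nil => exact h
  | cons v l =>
    rw [List.length_cons] at hl
    have hpick (u : V) : (2 : ℂ) • pick 1 (fun w l' => B u w • insertSeries 1 B c x y l') l ∈
        absSummable := by
      refine absSummable.smul_mem (pick_mem (S := absSummable.toSubmodule) 1 fun w l' h' => ?_) 2
      exact absSummable.smul_mem (ih l'.length (by omega) l' rfl) _
    rw [insertSeries_cons (one_mul 1) hB']
    refine absSummable.add_mem (hpick v) (absSummable.mul_mem X_mem_absSummable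
      (absSummable.sum_mem fun i _ => absSummable.smul_mem ?_ _))
    have h1 := congrArg ((insertMatrix 1 B c x y).adjugate *ᵥ ·)
      (insertMatrix_mulVec (c := c) (x := x) (y := y) (one_mul 1) hB' l)
    simp only [Matrix.mulVec_mulVec, Matrix.adjugate_mul, Matrix.smul_mulVec,
      Matrix.one_mulVec] at h1
    -- Multiplication by `P_[]²` replaces a division by the determinant, which need not be
    -- permissible in `absSummable` a priori.
    have h2 := congrArg (insertSeries 1 B c x y [] ^ 2 * ·) (congrFun h1 i)
    simp only [Pi.smul_apply, smul_eq_mul] at h2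
    rw [← mul_assoc, mul_comm (_ ^ 2), det_mul_insertSeries_sq hB, one_mul] at h2
    rw [h2]
    refine absSummable.mul_mem (absSummable.pow_mem h 2) (absSummable.sum_mem fun j _ =>
      absSummable.mul_mem (adjugate_mem _ (fun i j => ?_) _ _) (hpick _))
    refine absSummable.sub_mem ?_ (absSummable.mul_mem X_mem_absSummable
      (absSummable.algebraMap_mem (insertKernel 1 B c x y i j)))
    rw [Matrix.one_apply]
    split_ifs
    · exact absSummable.one_mem
    · exact absSummable.zero_mem

end AbsSummable

/-! ### Gluing of sums over pairings -/

section Glue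

open PowerSeries

variable {V ι : Type*} [AddCommGroup V] [Module ℂ V] [Fintype ι] {κ : ℂ}
  {B : V →ₗ⋆[ℂ] V →ₗ⋆[ℂ] ℂ} {c : ι → ℂ} {x y : ι → V}

variable (c x y) in
/-- The power series `insertSeries` as a conjugate linear map in its first vector. -/
def insertSeriesL (hκ : κ * κ = 1) (hB : ∀ v w, B v w = κ * B w v) (l : List V) :
    V →ₗ⋆[ℂ] ℂ⟦X⟧ where
  toFun v := insertSeries κ B c x y (v :: l)
  map_add' v w := by
    have h (i : ι ⊕ ι) : insertCoeff κ B c x y (v + w) i =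
        insertCoeff κ B c x y v i + insertCoeff κ B c x y w i := by
      cases i <;> simp [insertCoeff, mul_add]
    -- After one contraction, the first vector enters only through `B` and `insertCoeff`, where
    -- additivity is visible.
    rw [insertSeries_cons hκ hB (v + w), insertSeries_cons hκ hB v, insertSeries_cons hκ hB w]
    simp only [map_add, LinearMap.add_apply, add_smul, pick_add, h,
      Finset.sum_add_distrib, smul_add, mul_add]
    abel
  map_smul' a v := by
    have h (i : ι ⊕ ι) : insertCoeff κ B c x y (a • v) i =
        conj a * insertCoeff κ B c x y v i := by
      cases i <;> simp [insertCoeff, mul_left_comm]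
    rw [insertSeries_cons hκ hB (a • v), insertSeries_cons hκ hB v]
    simp only [map_smulₛₗ, LinearMap.smul_apply, smul_eq_mul, mul_smul, h,
      pick_smul, smul_add, ← Finset.smul_sum, mul_smul_comm]
    rw [smul_comm]

theorem insertSeriesL_apply (hκ : κ * κ = 1) (hB : ∀ v w, B v w = κ * B w v) (l : List V) (v : V) :
    insertSeriesL c x y hκ hB l v = insertSeries κ B c x y (v :: l) := rfl

theorem swapSymm_insertTerm (hκ : κ * κ = 1) (m : ℕ) : SwapSymm κ (insertTerm κ B c x y m) :=
  ((swapSymm_wick hκ).insertSum m).smul _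

variable (c x y) in
/-- The terms `insertTerm` as a conjugate bilinear map in the first two vectors. -/
def insertTermL (hκ : κ * κ = 1) (hB : ∀ v w, B v w = κ * B w v) (m : ℕ) (l : List V) :
    V →ₗ⋆[ℂ] V →ₗ⋆[ℂ] ℂ :=
  have h (v w : V) : insertTerm κ B c x y m (v :: w :: l) =
      coeff m (insertSeriesL c x y hκ hB (w :: l) v) := (coeff_insertSeries _ _).symm
  -- Linearity in the second vector is transported from the first by the exchange symmetry.
  have h' (v w : V) : insertTerm κ B c x y m (v :: w :: l) =
      κ * coeff m (insertSeriesL c x y hκ hB (v :: l) w) :=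
    (swapSymm_insertTerm hκ m [] v w l).trans (congrArg (κ * ·) (h w v))
  LinearMap.mk₂'ₛₗ (starRingEnd ℂ) (starRingEnd ℂ)
    (fun v w => insertTerm κ B c x y m (v :: w :: l))
    (fun v v' w => by simp only [h, map_add])
    (fun a v w => by simp only [h, map_smulₛₗ]; rfl)
    (fun v w w' => by simp only [h', map_add, mul_add])
    (fun a v w => by simp only [h', map_smulₛₗ, smul_eq_mul, mul_left_comm]; rfl)

/-- The terms `insertTerm` depend only on the tensor `∑ c a • x a ⊗ y a`. -/
theorem insertTerm_congr (hκ : κ * κ = 1) (hB : ∀ v w, B v w = κ * B w v) {ι' : Type*} [Fintype ι']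
    {c' : ι' → ℂ} {x' y' : ι' → V}
    (h : ∀ Ψ : V →ₗ⋆[ℂ] V →ₗ⋆[ℂ] ℂ, ∑ a, c a * Ψ (x a) (y a) = ∑ a, c' a * Ψ (x' a) (y' a))
    (m : ℕ) (l : List V) : insertTerm κ B c x y m l = insertTerm κ B c' x' y' m l := by
  induction m generalizing l with
  | zero => rfl
  | succ m ih =>
    have h2 : (m : ℂ) + 1 ≠ 0 := by exact_mod_cast m.succ_ne_zero
    refine mul_left_cancel₀ h2 ?_
    rw [insertTerm_succ, insertTerm_succ]
    simp only [ih]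
    -- The explicit pair produced by the derivative identity enters through a conjugate bilinear
    -- form, so the hypothesis on tensors applies to it.
    exact congrArg (2⁻¹ * ·) (h (insertTermL c' x' y' hκ hB m l))

theorem hasSum_pick {α : Type*} {f : ℕ → α → List α → ℂ} {g : α → List α → ℂ} {l : List α}
    (h : ∀ w l', l'.length + 1 = l.length → HasSum (fun m => f m w l') (g w l')) :
    HasSum (fun m => pick κ (f m) l) (pick κ g l) := by
  refine hasSum_sum fun i _ => (h _ _ ?_).mul_left _
  rw [List.length_eraseIdx_of_lt i.2]
  have := i.2
  omega

/-- If the contraction of each `v j = u j + w j` with inserted vectors leaves `w j`, and the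
remaining contractions of `v j` with `u k` are `B₁ j k`, then insertion multiplies the sum over
pairings for `B₁` by a constant. -/
theorem hasSum_insertTerm (hκ : κ * κ = 1) (hB : ∀ v w, B v w = κ * B w v) {J : Type*}
    {u v : J → V} {B₁ : J → J → ℂ} (hB₁ : ∀ j k, B₁ j k = κ * B₁ k j)
    (hu : ∀ j k, B (v j) (u k) = B₁ j k)
    (hv : ∀ j, v j = u j + ∑ i, conj (insertCoeff κ B c x y (v j) i) • Sum.elim x y i)
    (hS : ∀ l, insertSeries κ B c x y l ∈ absSummable) {C : ℂ}
    (hC : HasSum (fun m => insertTerm κ B c x y m []) C) (l : List J) :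
    HasSum (fun m => insertTerm κ B c x y m (l.map u)) (wick κ B₁ l * C) := by
  suffices ∀ n (l : List J), l.length = n →
      HasSum (fun m => insertTerm κ B c x y m (l.map u)) (wick κ B₁ l * C) from this _ l rfl
  intro n
  induction n using Nat.strong_induction_on with
  | _ n ih =>
  intro l hl
  cases l with
  | nil => simpa [wick_nil] using hC
  | cons j l =>
    rw [List.length_cons] at hl
    -- `D` is the effect of replacing `v j` by `v j - u j` in the first slot and also, with a factor
    -- `X`, the effect of contracting `v j` with the insertions.
    let D : ℂ⟦X⟧ := ∑ i, insertCoeff κ B c x y (v j) i •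
      insertSeries κ B c x y (Sum.elim x y i :: l.map u)
    have hD : D ∈ absSummable :=
      absSummable.sum_mem fun i _ => absSummable.smul_mem (hS _) _
    have h1 : insertSeries κ B c x y (u j :: l.map u) = (2 : ℂ) •
        pick κ (fun w l' => B (v j) w • insertSeries κ B c x y l') (l.map u) + (X * D - D) := by
      have h2 := congrArg (insertSeriesL c x y hκ hB (l.map u)) (hv j)
      simp only [map_add, map_sum, map_smulₛₗ, Complex.conj_conj, insertSeriesL_apply] at h2
      rw [insertSeries_cons hκ hB (v j)] at h2
      linear_combination -h2
    have h3 (m : ℕ) : insertTerm κ B c x y m (u j :: l.map u) =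
        2 * pick κ (fun k l' => B₁ j k * insertTerm κ B c x y m (l'.map u)) l +
          (coeff m (X * D) - coeff m D) := by
      rw [← coeff_insertSeries, h1, map_add, map_sub, map_smul, map_pick, pick_map]
      simp only [map_smul, coeff_insertSeries, hu, smul_eq_mul]
    have h4 : HasSum (fun m => pick κ (fun k l' => B₁ j k * insertTerm κ B c x y m (l'.map u)) l)
        (pick κ (fun k l' => B₁ j k * (wick κ B₁ l' * C)) l) :=
      hasSum_pick fun k l' h' => (ih l'.length (by omega) l' rfl).mul_left _
    have h5 : HasSum (fun m => coeff m D) (∑' m, coeff m D) := (Summable.of_norm hD).hasSum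
    -- Multiplication by `X` only shifts the coefficients, so `X * D` and `D` have the same sum and
    -- cancel.
    have h6 : HasSum (fun m => coeff m (X * D)) (∑' m, coeff m D) := by
      rw [← hasSum_nat_add_iff' 1]
      simpa [coeff_succ_X_mul] using h5
    have h7 := (h4.mul_left 2).add (h6.sub h5)
    rw [sub_self, add_zero] at h7
    rw [List.map_cons, funext h3, wick_cons hκ hB₁]
    have h8 : (fun k l' => B₁ j k * (wick κ B₁ l' * C)) = fun k l' => C * (B₁ j k * wick κ B₁ l') := by
      funext k l'
      ring
    rw [h8, pick_mul, mul_comm C, ← mul_assoc] at h7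
    exact h7

end Glue

/-! ### The bilinear form of an admissible subspace. -/

section AdmissiblePairing

variable {L : Type*} [NormedAddCommGroup L] [InnerProductSpace ℂ L] [CompleteSpace L]
  [KreinSpace L] {s : Statistics} {W : Submodule ℝ L}

theorem kip_zero_right (v : L) : kip v 0 = 0 := by simp [kip]

/-- On `W` the Hermitian product is real for bosons and purely imaginary for fermions. -/
theorem kip_comm_of_mem (hW : IsAdmissible s W) {v w : L} (hv : v ∈ W) (hw : w ∈ W) :
    kip v w = s.kappa * kip w v := by
  rw [← kip_conj v w]
  cases s with
  | boson =>
    have h := (hW.2.2 v).1 hv w hw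
    apply Complex.ext <;> simp [Statistics.kappa, h]
  | fermion =>
    have h := (hW.1 v).1 hv w hw
    apply Complex.ext <;> simp [Statistics.kappa, h]

variable (hW : IsAdmissible s W)

theorem pairing_comm (v w : L) : pairing hW v w = s.kappa * pairing hW w v := by
  have h {a b : L} (ha : a ∈ W) (hb : b ∈ W) := kip_comm_of_mem hW ha hb
  rw [pairing_eq, pairing_eq, h (rePart_mem hW v) (rePart_mem hW w),
    h (rePart_mem hW v) (imPart_mem hW w), h (imPart_mem hW v) (rePart_mem hW w),
    h (imPart_mem hW v) (imPart_mem hW w)]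
  ring

/-- With no imaginary part in `w`, the coefficient `-i` of the pairing is the one that conjugate
linearity of the Krein product in `v` produces. -/
theorem pairing_of_mem_right (v : L) {w : L} (hw : w ∈ W) : pairing hW v w = kip v w := by
  obtain ⟨h1, h2⟩ := parts_eq hW hw W.zero_mem (show w = w + Complex.I • 0 by simp)
  rw [pairing_eq, h1, h2]
  conv_rhs => rw [rePart_add_imPart hW v, kip_add_left, kip_smul_left]
  simp [kip_zero_right]
  ring

theorem pairing_of_mem_left {v : L} (hv : v ∈ W) (w : L) :
    pairing hW v w = s.kappa * kip w v := by rw [pairing_comm, pairing_of_mem_right hW w hv]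

end AdmissiblePairing

/-! ### Orthonormal bases of Krein subspaces and independence of their choice. -/

section Basis

variable {L : Type*} [NormedAddCommGroup L] [InnerProductSpace ℂ L] [CompleteSpace L]
  [KreinSpace L] {A : Submodule ℂ L} {d : ℕ} {ξ : Fin d → L}

theorem kip_of_mem_pos {v : L} (hv : v ∈ posPart L) (w : L) : kip v w = inner ℂ v w := by
  have h : v ∈ (negPart L)ᗮ := (posPart L).le_orthogonal_orthogonal hv
  rw [kip, (Submodule.starProjection_apply_eq_zero_iff _).2 h, inner_zero_left, sub_zero,
    ← Submodule.inner_starProjection_left_eq_right,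
    Submodule.starProjection_eq_self_iff.2 (Submodule.starProjection_apply_mem _ _),
    Submodule.starProjection_eq_self_iff.2 hv]

theorem kip_of_mem_neg {v : L} (hv : v ∈ negPart L) (w : L) : kip v w = -inner ℂ v w := by
  rw [kip, (Submodule.starProjection_apply_eq_zero_iff _).2 hv, inner_zero_left, zero_sub,
    ← Submodule.inner_starProjection_left_eq_right,
    Submodule.starProjection_eq_self_iff.2 (Submodule.starProjection_apply_mem _ _),
    Submodule.starProjection_eq_self_iff.2 hv]

theorem IsONBasis.kip_eq (h : IsONBasis A ξ) (a : Fin d) (w : L) :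
    kip (ξ a) w = (-1) ^ sig (ξ a) * inner ℂ (ξ a) w := by
  have h0 : ξ a ≠ 0 := h.2.1.ne_zero a
  by_cases hp : ξ a ∈ posPart L
  · simp [sig, hp, kip_of_mem_pos hp]
  · simp [sig, hp, kip_of_mem_neg ((h.1 a).resolve_left hp)]

theorem IsONBasis.sum_inner (h : IsONBasis A ξ) {v : L} (hv : v ∈ A) :
    ∑ a, inner ℂ (ξ a) v • ξ a = v := by
  rw [← h.2.2] at hv
  obtain ⟨c, rfl⟩ := (Submodule.mem_span_range_iff_exists_fun ℂ).1 hv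
  exact Finset.sum_congr rfl fun a _ => by rw [h.2.1.inner_right_fintype]

theorem IsONBasis.mem (h : IsONBasis A ξ) (a : Fin d) : ξ a ∈ A :=
  h.2.2 ▸ Submodule.subset_span ⟨a, rfl⟩

/-- The signed tensor `∑ (-1)^[ξ_a] ξ_a ⊗ ξ̄_a` depends only on `A`. Expand one factor of each side
in the other basis and compare. -/
theorem IsONBasis.sum_congr {E : Type*} [AddCommGroup E] [Module ℂ E] (h : IsONBasis A ξ) {d' : ℕ}
    {η : Fin d' → L} (h' : IsONBasis A η) (x : L →ₗ[ℂ] E) (y : L →ₗ⋆[ℂ] E)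
    (Ψ : E →ₗ⋆[ℂ] E →ₗ⋆[ℂ] ℂ) : ∑ a, (-1) ^ sig (ξ a) * Ψ (x (ξ a)) (y (ξ a)) =
      ∑ b, (-1) ^ sig (η b) * Ψ (x (η b)) (y (η b)) := by
  -- Basis vectors of opposite sign are orthogonal, so the two sign factors agree wherever the inner
  -- product is nonzero.
  have h1 (a : Fin d) (b : Fin d') : (-1) ^ sig (ξ a) * inner ℂ (η b) (ξ a) =
      (-1) ^ sig (η b) * inner ℂ (η b) (ξ a) := by
    rw [← h'.kip_eq, ← kip_conj, h.kip_eq, map_mul, inner_conj_symm]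
    simp
  have h2 (a : Fin d) : Ψ (x (ξ a)) (y (ξ a)) =
      ∑ b, inner ℂ (η b) (ξ a) * Ψ (x (ξ a)) (y (η b)) := by
    have h4 := congrArg (fun v => Ψ (x (ξ a)) (y v)) (h'.sum_inner (h.mem a))
    rw [← h4]
    simp only [map_sum, map_smulₛₗ, Complex.conj_conj, smul_eq_mul]
  have h3 (b : Fin d') : Ψ (x (η b)) (y (η b)) =
      ∑ a, inner ℂ (η b) (ξ a) * Ψ (x (ξ a)) (y (η b)) := by
    have h4 := congrArg (fun v => Ψ (x v) (y (η b))) (h.sum_inner (h'.mem b))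
    rw [← h4]
    simp [LinearMap.sum_apply]
  simp only [h2, h3, Finset.mul_sum, ← mul_assoc, h1]
  exact Finset.sum_comm

end Basis

theorem pairSum_map {α β : Type*} (κ : ℂ) (B : α → α → ℂ) (f : β → α) (k : ℕ) (l : List β) :
    pairSum κ B k (l.map f) = pairSum κ (fun a b => B (f a) (f b)) k l := by
  induction k generalizing l with
  | zero => simp [pairSum]
  | succ k ih => simp only [pairSum, pick_map, ih]

/-- This lets one list of indices carry both the boundary vectors `(φ_i, 0, 0)` and the vectors
`φ_i` of `L_{Σ₁}`. -/
theorem wick_map {α β : Type*} (κ : ℂ) (B : α → α → ℂ) (f : β → α) (l : List β) :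
    wick κ B (l.map f) = wick κ (fun a b => B (f a) (f b)) l := by
  rw [wick, wick, pairSum_map, List.length_map]

/-! ### Embeddings into the boundary space. -/

section Boundary

variable (L₁ : Type*) [NormedAddCommGroup L₁] [InnerProductSpace ℂ L₁]
  {LS : Type*} [NormedAddCommGroup LS] [InnerProductSpace ℂ LS]
  {LS' : Type*} [NormedAddCommGroup LS'] [InnerProductSpace ℂ LS']

variable (LS LS') in
/-- The embedding `y ↦ (0, y, 0)` of `L_Σ` in `L_{∂M}`. -/
def tripleSnd : LS →ₗ[ℂ] Boundary L₁ LS LS' where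
  toFun y := triple 0 y 0
  map_add' a b := by simp [triple, ← WithLp.toLp_add]
  map_smul' a b := by simp [triple, ← WithLp.toLp_smul]

/-- The embedding `y ↦ (0, 0, ȳ)` of `L_Σ` in `L_{∂M}`. -/
def tripleBar (bar : LS ≃SL[starRingEnd ℂ] LS') : LS →ₗ⋆[ℂ] Boundary L₁ LS LS' where
  toFun y := triple 0 0 (bar y)
  map_add' a b := by simp [triple, ← WithLp.toLp_add]
  map_smul' a b := by simp [triple, ← WithLp.toLp_smul, map_smulₛₗ]

variable [CompleteSpace L₁] [KreinSpace L₁] [CompleteSpace LS] [KreinSpace LS] [CompleteSpace LS']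
  [KreinSpace LS']

variable {L₁} in
theorem kip_triple (x x' : L₁) (y y' : LS) (z z' : LS') :
    kip (triple x y z) (triple x' y' z') = kip x x' + kip y y' + kip z z' := by
  rw [kip_prod, kip_prod]
  rfl

end Boundary

/-! ### The gluing terms as sums with inserted pairs. -/

namespace Gluing

variable {s : Statistics}
  {L₁ : Type*} [NormedAddCommGroup L₁] [InnerProductSpace ℂ L₁] [CompleteSpace L₁] [KreinSpace L₁]
  {LS : Type*} [NormedAddCommGroup LS] [InnerProductSpace ℂ LS] [CompleteSpace LS] [KreinSpace LS]
  {LS' : Type*} [NormedAddCommGroup LS'] [InnerProductSpace ℂ LS'] [CompleteSpace LS']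
  [KreinSpace LS'] {LM LM₁ : Type*} [AddCommGroup LM] [Module ℝ LM] [AddCommGroup LM₁]
  [Module ℝ LM₁] (G : Gluing s L₁ LS LS' LM LM₁)

theorem state_cs {n m : ℕ} (φ : Fin n → L₁) (ξ : Fin m → LS) :
    G.state ⟨cs s φ, cs_mem s φ⟩ ⟨cs s ξ, cs_mem s ξ⟩ =
      s.kappa ^ m • ⟨cs s (Fin.append (Fin.append (fun i => triple (φ i) 0 0)
        fun i => triple 0 (ξ i) 0) fun i => triple 0 0 (G.bar (ξ i.rev))), cs_mem s _⟩ := by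
  refine Subtype.ext ?_
  change tau s (tau s (cs s φ) (cs s ξ)) (iota s G.bar (cs s ξ)) = s.kappa ^ m • cs s _
  rw [iota_cs s G.bar G.kip_bar, tau_cs, map_smul, tau_cs]
  congr 3
  funext i
  refine Fin.addCases (fun i => ?_) (fun i => ?_) i
  · simp only [Fin.append_left]; rfl
  · simp only [Fin.append_right]; rfl

/-- Each inserted vector contributes one `κ` from `ι`, which is absorbed into the weight next to the
sign `(-1)^[ξ_a]`. -/
theorem term_cs {n d : ℕ} (φ : Fin n → L₁) (ξ : Fin d → LS) (m : ℕ) :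
    G.term ⟨cs s φ, cs_mem s φ⟩ ξ m = insertTerm s.kappa (pairingL G.admissible)
      (fun a => s.kappa * (-1) ^ sig (ξ a)) (fun a => tripleSnd L₁ LS LS' (ξ a))
      (fun a => tripleBar L₁ G.bar (ξ a)) m (List.ofFn fun i => triple (φ i) 0 0) := by
  rw [term, insertTerm, one_div]
  congr 1
  rw [← sum_prod_mul_insert s.kappa_mul_self (swapSymm_wick s.kappa_mul_self)]
  refine Finset.sum_congr rfl fun a _ => ?_
  rw [state_cs, map_smul, amplitude_cs, amplitudeValue_eq_wick, List.ofFn_fin_append,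
    List.ofFn_fin_append, smul_eq_mul, ← mul_assoc, Finset.prod_mul_distrib, Finset.prod_const,
    Finset.card_univ, Fintype.card_fin, Finset.prod_pow_eq_pow_sum, mul_comm (_ ^ m)]
  rfl

theorem term_vacuum {d : ℕ} (ξ : Fin d → LS) (m : ℕ) :
    G.term ⟨vacuum s, vacuum_mem s⟩ ξ m = insertTerm s.kappa (pairingL G.admissible)
      (fun a => s.kappa * (-1) ^ sig (ξ a)) (fun a => tripleSnd L₁ LS LS' (ξ a))
      (fun a => tripleBar L₁ G.bar (ξ a)) m [] := by
  have h : (⟨vacuum s, vacuum_mem s⟩ : genSpan s L₁) = ⟨cs s Fin.elim0, cs_mem s _⟩ :=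
    Subtype.ext (cs_empty s _).symm
  rw [h, term_cs]
  rfl

/-- Since the triple lies in `L_M̃`, its pairings with inserted vectors are Krein products. The
weights cancel their signs, so the coefficients are those of `φt` in the basis `ξ`; `φt ∈ A` makes
the expansion complete. -/
theorem triple_eq_add_sum {A : Submodule ℂ LS} {d : ℕ} {ξ : Fin d → LS} (hξ : IsONBasis A ξ)
    {φ : L₁} {φt : LS} (h : triple φ φt (G.bar φt) ∈ LinearMap.range G.rM) (hA : φt ∈ A) :
    triple φ φt (G.bar φt) = triple φ 0 0 +
      ∑ i, conj (insertCoeff s.kappa (pairingL G.admissible)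
        (fun a => s.kappa * (-1) ^ sig (ξ a)) (fun a => tripleSnd L₁ LS LS' (ξ a))
        (fun a => tripleBar L₁ G.bar (ξ a)) (triple φ φt (G.bar φt)) i) •
          Sum.elim (fun a => tripleSnd L₁ LS LS' (ξ a)) (fun a => tripleBar L₁ G.bar (ξ a)) i := by
  have hs (a : Fin d) : ((-1 : ℂ) ^ sig (ξ a)) * (-1) ^ sig (ξ a) = 1 := by
    rw [← mul_pow]; simp
  have h1 (a : Fin d) : pairing G.admissible (triple φ φt (G.bar φt)) (tripleSnd L₁ LS LS' (ξ a)) =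
      s.kappa * ((-1) ^ sig (ξ a) * inner ℂ (ξ a) φt) := by
    rw [pairing_of_mem_left _ h]
    change s.kappa * kip (triple 0 (ξ a) 0) _ = _
    rw [kip_triple, kip_zero_left, kip_zero_left, zero_add, add_zero, hξ.kip_eq]
  have h2 (a : Fin d) : pairing G.admissible (triple φ φt (G.bar φt)) (tripleBar L₁ G.bar (ξ a)) =
      conj ((-1) ^ sig (ξ a) * inner ℂ (ξ a) φt) := by
    rw [pairing_of_mem_left _ h]
    change s.kappa * kip (triple 0 0 (G.bar (ξ a))) _ = _
    rw [kip_triple, kip_zero_left, kip_zero_left, zero_add, zero_add, G.kip_bar, hξ.kip_eq,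
      ← mul_assoc, s.kappa_mul_self, one_mul]
  have hk := s.kappa_mul_self
  have e1 (a : Fin d) : conj (s.kappa * (s.kappa * (-1) ^ sig (ξ a)) *
      conj ((-1) ^ sig (ξ a) * inner ℂ (ξ a) φt)) = inner ℂ (ξ a) φt := by
    rw [← mul_assoc, hk, one_mul, map_mul, Complex.conj_conj, map_pow, map_neg, map_one, ← mul_assoc,
      hs, one_mul]
  have e2 (a : Fin d) : s.kappa * (-1) ^ sig (ξ a) *
      (s.kappa * ((-1) ^ sig (ξ a) * inner ℂ (ξ a) φt)) = inner ℂ (ξ a) φt := by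
    linear_combination (s.kappa * s.kappa * inner ℂ (ξ a) φt) * hs a + inner ℂ (ξ a) φt * hk
  rw [Fintype.sum_sum_type]
  simp only [insertCoeff, Sum.elim_inl, Sum.elim_inr, pairingL_apply, h1, h2, e1, e2]
  have h3 : ∑ a, inner ℂ (ξ a) φt • tripleSnd L₁ LS LS' (ξ a) = tripleSnd L₁ LS LS' φt := by
    simp only [← map_smul, ← map_sum, hξ.sum_inner hA]
  have h4 : ∑ a, conj (inner ℂ (ξ a) φt) • tripleBar L₁ G.bar (ξ a) = tripleBar L₁ G.bar φt := by
    conv_rhs => rw [← hξ.sum_inner hA, map_sum]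
    simp only [map_smulₛₗ]
  rw [h3, h4]
  simp [tripleSnd, tripleBar, triple, ← WithLp.toLp_add]

/-- The hypothesis on the vacuum series matters for bosons only; for fermions all the series are
polynomials. -/
theorem insertSeries_mem_absSummable {d : ℕ} {c : Fin d → ℂ} {x y : Fin d → Boundary L₁ LS LS'}
    (h : insertSeries s.kappa (pairingL G.admissible) c x y [] ∈ absSummable)
    (l : List (Boundary L₁ LS LS')) :
    insertSeries s.kappa (pairingL G.admissible) c x y l ∈ absSummable := by
  have hB := pairing_comm G.admissible
  cases s with
  | boson => exact insertSeries_mem_absSummable_of_one (fun v w => (hB v w).trans (one_mul _)) h l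
  | fermion => exact insertSeries_mem_absSummable_of_neg_one l

end Gluing
end GBF
end

/-- `HasSum` is unconditional convergence, which for complex series is absolute convergence. -/
theorem mainTheorem3 (s : Statistics)
    {L₁ : Type*} [NormedAddCommGroup L₁] [InnerProductSpace ℂ L₁] [CompleteSpace L₁]
    [KreinSpace L₁]
    {LS : Type*} [NormedAddCommGroup LS] [InnerProductSpace ℂ LS] [CompleteSpace LS]
    [KreinSpace LS]
    {LS' : Type*} [NormedAddCommGroup LS'] [InnerProductSpace ℂ LS'] [CompleteSpace LS']
    [KreinSpace LS']
    {LM : Type*} [AddCommGroup LM] [Module ℝ LM] {LM₁ : Type*} [AddCommGroup LM₁] [Module ℝ LM₁]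
    (G : Gluing s L₁ LS LS' LM LM₁)
    (n : ℕ) (φ : Fin n → L₁) (hφ : ∀ i, φ i ∈ LinearMap.range G.rM₁)
    (φt : Fin n → LS)
    (hφt : ∀ i, triple (φ i) (φt i) (G.bar (φt i)) ∈ LinearMap.range G.rM)
    (A : Submodule ℂ LS) (hA : IsFinKreinSubspace A) (hφtA : ∀ i, φt i ∈ A)
    (c : ℂ) (hc : G.IsRestrictedAnomaly A c)
    {d : ℕ} (ξ : Fin d → LS) (hξ : IsONBasis A ξ) :
    HasSum (fun m : ℕ => G.term ⟨cs s φ, cs_mem s φ⟩ ξ m)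
      (amplitude G.admissible₁ ⟨cs s φ, cs_mem s φ⟩ * c) := by
  obtain ⟨d', η, hη, hsum, rfl⟩ := hc
  have hk := s.kappa_mul_self
  have hB (v w) : pairingL G.admissible v w = s.kappa * pairingL G.admissible w v :=
    pairing_comm G.admissible v w
  -- The anomaly factor is given in some basis `η`; its terms agree one by one with those for `ξ`.
  have hηξ (m : ℕ) : G.term ⟨vacuum s, vacuum_mem s⟩ η m = insertTerm s.kappa
      (pairingL G.admissible) (fun a => s.kappa * (-1) ^ sig (ξ a))
      (fun a => tripleSnd L₁ LS LS' (ξ a)) (fun a => tripleBar L₁ G.bar (ξ a)) m [] := by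
    rw [G.term_vacuum]
    refine insertTerm_congr hk hB (fun Ψ => ?_) m []
    simp only [mul_assoc, ← Finset.mul_sum]
    rw [hη.sum_congr hξ]
  simp only [hηξ] at hsum ⊢
  have hS := G.insertSeries_mem_absSummable (x := fun a => tripleSnd L₁ LS LS' (ξ a))
    (y := fun a => tripleBar L₁ G.bar (ξ a)) (c := fun a => s.kappa * (-1) ^ sig (ξ a))
    (by simp only [← coeff_insertSeries] at hsum; exact hsum)
  -- Here `u` and `v` are the boundary data without and with the values on the glued hypersurface.
  -- The contraction of `v i` with `u j` is computed by the Krein product, of which only the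
  -- `L_{Σ₁}` component survives.
  have main := hasSum_insertTerm hk hB (J := Fin n) (u := fun i => triple (φ i) 0 0)
    (v := fun i => triple (φ i) (φt i) (G.bar (φt i)))
    (B₁ := fun i j => pairing G.admissible₁ (φ i) (φ j)) (fun i j => pairing_comm _ _ _)
    (fun i j => by
      rw [pairingL_apply, pairing_of_mem_left _ (hφt i), pairing_of_mem_left _ (hφ i), kip_triple,
        kip_zero_left, kip_zero_left, add_zero, add_zero])
    (fun i => G.triple_eq_add_sum hξ (hφt i) (hφtA i)) hS (Summable.of_norm hsum).hasSum
    (List.finRange n)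
  rw [← wick_map s.kappa (pairing G.admissible₁) φ, ← List.ofFn_eq_map, ← List.ofFn_eq_map,
    ← amplitudeValue_eq_wick] at main
  simpa only [G.term_cs, amplitude_cs] using main
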